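/- Let $\mathbb{C}(v)$ be the field of rational functions, $[s]=\frac{v^s-v^{-s}}{v-v^{-1}}$ and $[t]!=[t][t-1]\cdots[1]$. Let $\rho$ be the cyclic permutation of the three colours $\{g,o,p\}$ with $\rho(g)=o$, $\rho(o)=p$, $\rho(p)=g$. The trihedral Hecke algebra $T_\infty$ is the associative unital $\mathbb{C}(v)$-algebra generated by $\theta_g,\theta_o,\theta_p$ with the relations $$\theta_u^2=[3]!\,\theta_u,\qquad \theta_u\theta_{\rho(u)}\theta_u=\theta_u\theta_{\rho^{-1}(u)}\theta_u\qquad(u\in\{g,o,p\}).$$ For a colour $u$ and $k,l\ge 0$ let $h^u_{k,l}=\theta_{u_{k+l}}\cdots\theta_{u_1}\theta_{u_0}$, where $u_0=u$, $u_{i+1}=\rho(u_i)$ for $0\le i<k$ and $u_{i+1}=\rho^{-1}(u_i)$ for $k\le i<k+l$ (by the relations, any other order of the $k$ rotations $\rho$ and $l$ rotations $\rho^{-1}$ gives the same element). Let $L_{m,n}$ be the simple finite-dimensional $\mathfrak{sl}_3$-module of highest weight $m\omega_1+n\omega_2$, put $X=L_{1,0}$, $Y=L_{0,1}$, and let $d^{k,l}_{m,n}\in\mathbb{Z}$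 be the unique integers, finitely many non-zero for given $m,n$, with $[L_{m,n}]=\sum_{k,l}d^{k,l}_{m,n}[X^{\otimes k}\otimes Y^{\otimes l}]$ in the Grothendieck ring of finite-dimensional $\mathfrak{sl}_3$-modules. For $m,n\ge 0$ define the right and left coloured Kazhdan–Lusztig elements of $T_\infty$ by $$C^u_{m,n}=\sum_{k,l}[2]^{-k-l}\,d^{k,l}_{m,n}\,h^u_{k,l},\qquad {}^{w}C_{m,n}=C^{u}_{m,n}\ \text{ for the colour } u \text{ with } w=\rho^{m-n}(u).$$ For $e\ge 0$ let $I_e$ be the two-sided ideal of $T_\infty$ generated by all $C^u_{m,n}$ with $m+n=e+1$ and $u\in\{g,o,p\}$, and let $T_e=T_\infty/I_e$. **Proposition.** For every integer $e\ge 0$, the images in $T_e$ of the (pairwise distinct) elements of each of the two families $$1,\ C^u_{m,n}\quad(m,n\ge 0,\ m+n\le e,\ u\in\{g,o,p\})\qquad\text{and}\qquad 1,\ {}^{u}C_{m,n}\quad(m,n\ge 0,\ m+n\le e,\ u\in\{g,o,p\})$$ form a basis of $T_e$ over $\mathbb{C}(v)$. Hence $\dim_{\mathbb{C}(v)}T_e=3\,\frac{(e+1)(e+2)}{2}+1$.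 -/

import Mathlib

namespace Trihedral

/-! ### Simple `sl₃`-modules, their characters, and the integers `d^{k,l}_{m,n}` -/

section SlThree

open MvPolynomial

attribute [local instance] LieRing.ofAssociativeRing

/-- The Lie algebra `sl₃(ℂ)` of traceless `3 × 3` matrices. -/
abbrev sl3 : LieSubalgebra ℂ (Matrix (Fin 3) (Fin 3) ℂ) :=
  LieAlgebra.SpecialLinear.sl (Fin 3) ℂ

/-- The polynomial ring `ℂ[x₀,x₁,x₂,y₀,y₁,y₂] = ⨁_{m,n} Symᵐ(V) ⊗ Symⁿ(V*)`, where `x₀,x₁,x₂` is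
the standard basis of the vector representation `V = ℂ³` of `sl₃` and `y₀,y₁,y₂` is the dual basis
of `V*`. The variable `x_j` is `X (Sum.inl j)` and the variable `y_j` is `X (Sum.inr j)`. -/
abbrev SymPoly : Type := MvPolynomial (Fin 3 ⊕ Fin 3) ℂ

/-- The derivation by which a matrix `A` acts on `Sym(V) ⊗ Sym(V*)`:
it extends `A x_j = ∑ i, A i j x_i` and `A y_j = - ∑ i, A j i y_i`. -/
noncomputable def actDer (A : Matrix (Fin 3) (Fin 3) ℂ) : Derivation ℂ SymPoly SymPoly :=
  mkDerivation ℂ (Sum.elim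
    (fun j => ∑ i, A i j • (X (Sum.inl i) : SymPoly))
    (fun j => -∑ i, A j i • (X (Sum.inr i) : SymPoly)))

theorem actDer_inl (A : Matrix (Fin 3) (Fin 3) ℂ) (j : Fin 3) :
    actDer A (X (Sum.inl j)) = ∑ i, A i j • (X (Sum.inl i) : SymPoly) := by
  rw [actDer, mkDerivation_X, Sum.elim_inl]

theorem actDer_inr (A : Matrix (Fin 3) (Fin 3) ℂ) (j : Fin 3) :
    actDer A (X (Sum.inr j)) = -∑ i, A j i • (X (Sum.inr i) : SymPoly) := by
  rw [actDer, mkDerivation_X, Sum.elim_inr]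

theorem actDer_add (A B : Matrix (Fin 3) (Fin 3) ℂ) : actDer (A + B) = actDer A + actDer B := by
  apply derivation_ext
  rintro (j | j)
  · rw [Derivation.add_apply, actDer_inl, actDer_inl, actDer_inl, ← Finset.sum_add_distrib]
    exact Finset.sum_congr rfl fun i _ => by rw [Matrix.add_apply, add_smul]
  · rw [Derivation.add_apply, actDer_inr, actDer_inr, actDer_inr, ← neg_add,
      ← Finset.sum_add_distrib]
    exact congrArg _ (Finset.sum_congr rfl fun i _ => by rw [Matrix.add_apply, add_smul])

theorem actDer_smul (c : ℂ) (A : Matrix (Fin 3) (Fin 3) ℂ) : actDer (c • A) = c • actDer A := by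
  apply derivation_ext
  rintro (j | j)
  · rw [Derivation.smul_apply, actDer_inl, actDer_inl, Finset.smul_sum]
    exact Finset.sum_congr rfl fun i _ => by rw [Matrix.smul_apply, smul_eq_mul, mul_smul]
  · rw [Derivation.smul_apply, actDer_inr, actDer_inr, smul_neg, Finset.smul_sum]
    exact congrArg _ (Finset.sum_congr rfl fun i _ => by
      rw [Matrix.smul_apply, smul_eq_mul, mul_smul])

theorem actDer_actDer_inl (A B : Matrix (Fin 3) (Fin 3) ℂ) (j : Fin 3) :
    actDer A (actDer B (X (Sum.inl j))) = actDer (A * B) (X (Sum.inl j)) := by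
  rw [actDer_inl, actDer_inl, map_sum]
  simp only [Derivation.map_smul, actDer_inl, Finset.smul_sum, smul_smul, Matrix.mul_apply,
    Finset.sum_smul]
  rw [Finset.sum_comm]
  exact Finset.sum_congr rfl fun i _ => Finset.sum_congr rfl fun k _ => by rw [mul_comm]

theorem actDer_actDer_inr (A B : Matrix (Fin 3) (Fin 3) ℂ) (j : Fin 3) :
    actDer A (actDer B (X (Sum.inr j))) = -actDer (B * A) (X (Sum.inr j)) := by
  rw [actDer_inr, actDer_inr, map_neg, map_sum]
  simp only [Derivation.map_smul, actDer_inr, smul_neg, Finset.sum_neg_distrib, neg_neg,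
    Finset.smul_sum, smul_smul, Matrix.mul_apply, Finset.sum_smul]
  rw [Finset.sum_comm]

theorem actDer_lie (A B : Matrix (Fin 3) (Fin 3) ℂ) :
    actDer (A * B - B * A) = ⁅actDer A, actDer B⁆ := by
  have hsub : actDer (A * B - B * A) = actDer (A * B) - actDer (B * A) := by
    rw [sub_eq_add_neg, actDer_add, ← neg_one_smul ℂ (B * A), actDer_smul]
    apply derivation_ext
    intro i
    rw [Derivation.add_apply, Derivation.smul_apply, Derivation.sub_apply, neg_one_smul,
      ← sub_eq_add_neg]
  rw [hsub]
  apply derivation_ext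
  rintro (j | j)
  · rw [Derivation.commutator_apply, actDer_actDer_inl, actDer_actDer_inl, Derivation.sub_apply]
  · rw [Derivation.commutator_apply, actDer_actDer_inr, actDer_actDer_inr, Derivation.sub_apply]
    abel

/-- The action of `sl₃` on `Sym(V) ⊗ Sym(V*)`, as a homomorphism of Lie algebras. -/
noncomputable def actHom : sl3 →ₗ⁅ℂ⁆ Derivation ℂ SymPoly SymPoly where
  toFun A := actDer A.1
  map_add' A B := actDer_add A.1 B.1
  map_smul' c A := actDer_smul c A.1
  map_lie' {A B} := actDer_lie A.1 B.1

noncomputable instance : LieRingModule sl3 SymPoly := LieRingModule.compLieHom SymPoly actHom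

instance : LieModule ℂ sl3 SymPoly := LieModule.compLieHom SymPoly actHom

/-- The simple `sl₃`-module `L_{m,n}` with highest weight `m ω₁ + n ω₂`, realised as the Cartan
component of `Symᵐ(V) ⊗ Symⁿ(V*)`: the `sl₃`-submodule generated by the highest weight vector
`x₀ᵐ y₂ⁿ`. In particular `L_{1,0} = V` and `L_{0,1} = V*`. -/
noncomputable def simpleModule (m n : ℕ) : LieSubmodule ℂ sl3 SymPoly :=
  LieSubmodule.lieSpan ℂ sl3 {(X (Sum.inl 0) ^ m * X (Sum.inr 2) ^ n : SymPoly)}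

/-- The simple coroot `α₁^∨ = diag(1,-1,0)`. -/
def coroot₁ : sl3 :=
  ⟨Matrix.diagonal ![1, -1, 0], by
    simp [LieAlgebra.SpecialLinear.sl, Matrix.trace, Fin.sum_univ_three, LinearMap.mem_ker]⟩

/-- The simple coroot `α₂^∨ = diag(0,1,-1)`. -/
def coroot₂ : sl3 :=
  ⟨Matrix.diagonal ![0, 1, -1], by
    simp [LieAlgebra.SpecialLinear.sl, Matrix.trace, Fin.sum_univ_three, LinearMap.mem_ker]⟩

/-- The weight space of the `sl₃`-module `M` for the integral weight `a ω₁ + b ω₂`,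
`μ = (a, b)`. -/
def weightSpace (M : Type*) [AddCommGroup M] [Module ℂ M] [LieRingModule sl3 M]
    [LieModule ℂ sl3 M] (μ : ℤ × ℤ) : Submodule ℂ M :=
  Module.End.eigenspace (LieModule.toEnd ℂ sl3 M coroot₁) (μ.1 : ℂ) ⊓
    Module.End.eigenspace (LieModule.toEnd ℂ sl3 M coroot₂) (μ.2 : ℂ)

/-- The formal character `∑_μ dim(M_μ) e^μ` of a finite-dimensional `sl₃`-module `M`, an element of
the group ring of the weight lattice `ℤ²`. (Only finitely many terms are non-zero.) The character
is injective on the Grothendieck ring of finite-dimensional `sl₃`-modules, so that it represents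
the class `[M]`; the product of two characters is the class of the tensor product. -/
noncomputable def character (M : Type*) [AddCommGroup M] [Module ℂ M] [LieRingModule sl3 M]
    [LieModule ℂ sl3 M] : AddMonoidAlgebra ℤ (ℤ × ℤ) :=
  ∑ᶠ μ : ℤ × ℤ, AddMonoidAlgebra.single μ (Module.finrank ℂ (weightSpace M μ) : ℤ)

/-- The class `[L_{m,n}]`. -/
noncomputable def simpleClass (m n : ℕ) : AddMonoidAlgebra ℤ (ℤ × ℤ) :=
  character (simpleModule m n)

/-- The finitely supported family `(k,l) ↦ d^{k,l}_{m,n}` of integers, the unique one with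
`[L_{m,n}] = ∑_{k,l} d^{k,l}_{m,n} [X^k Y^l]`, where `X = L_{1,0}` and `Y = L_{0,1}`. -/
noncomputable def dCoeff (m n : ℕ) : ℕ × ℕ →₀ ℤ :=
  Classical.epsilon fun d : ℕ × ℕ →₀ ℤ =>
    simpleClass m n = d.sum fun kl a => a • (simpleClass 1 0 ^ kl.1 * simpleClass 0 1 ^ kl.2)

end SlThree

/-! ### The trihedral Hecke algebras -/

section Hecke

/-- The ground field `ℂ(v)`. -/
abbrev Cv : Type := RatFunc ℂ

/-- The `v`-number `[s] = (v^s - v^{-s}) / (v - v^{-1})`. -/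
noncomputable def vNumber (s : ℤ) : Cv :=
  (RatFunc.X ^ s - RatFunc.X ^ (-s)) / (RatFunc.X - RatFunc.X⁻¹)

/-- The `v`-factorial `[t]! = [t][t-1]⋯[1]`. -/
noncomputable def vFactorial (t : ℕ) : Cv :=
  ∏ i ∈ Finset.range t, vNumber ((i : ℤ) + 1)

/-- The secondary colours green `g = 0`, orange `o = 1`, purple `p = 2`. The cyclic rotation `ρ`
with `ρ(g) = o`, `ρ(o) = p`, `ρ(p) = g` is `u ↦ u + 1`, and so `ρ^s(u) = u + s`. -/
abbrev Color : Type := ZMod 3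

/-- The defining relations of the trihedral Hecke algebra of level `∞`. -/
inductive Rel : FreeAlgebra Cv Color → FreeAlgebra Cv Color → Prop
  | quadratic (u : Color) :
      Rel (FreeAlgebra.ι Cv u * FreeAlgebra.ι Cv u) (vFactorial 3 • FreeAlgebra.ι Cv u)
  | cubic (u : Color) :
      Rel (FreeAlgebra.ι Cv u * FreeAlgebra.ι Cv (u + 1) * FreeAlgebra.ι Cv u)
        (FreeAlgebra.ι Cv u * FreeAlgebra.ι Cv (u - 1) * FreeAlgebra.ι Cv u)

/-- The trihedral Hecke algebra `T_∞` of level `∞`. -/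
abbrev TInfty : Type := RingQuot Rel

/-- The generator `θ_u` of `T_∞`. -/
noncomputable def theta (u : Color) : TInfty :=
  RingQuot.mkAlgHom Cv Rel (FreeAlgebra.ι Cv u)

/-- The element `h^u_{k,l} = θ_{u_{k+l}} ⋯ θ_{u_1} θ_{u_0}` with `u_0 = u`, where the colour is
first rotated `k` times by `ρ` and then `l` times by `ρ⁻¹` (by the cubic relations the order of
these rotations does not matter). -/
noncomputable def hElt (u : Color) : ℕ → ℕ → TInfty
  | 0, 0 => theta u
  | k + 1, 0 => theta (u + (k + 1 : ℕ)) * hElt u k 0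
  | k, l + 1 => theta (u + (k : ℕ) - (l + 1 : ℕ)) * hElt u k l

/-- The right coloured Kazhdan–Lusztig element
`C^u_{m,n} = ∑_{k,l} [2]^{-k-l} d^{k,l}_{m,n} h^u_{k,l}` with (right) starting colour `u`. -/
noncomputable def rightKL (u : Color) (m n : ℕ) : TInfty :=
  (dCoeff m n).sum fun kl a =>
    (vNumber 2 ^ (-(kl.1 : ℤ) - (kl.2 : ℤ)) * (a : Cv)) • hElt u kl.1 kl.2

/-- The left coloured Kazhdan–Lusztig element `^vC_{m,n}`: it is `C^u_{m,n}` for the colour `u` with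
`v = ρ^{m-n}(u)`. -/
noncomputable def leftKL (v : Color) (m n : ℕ) : TInfty :=
  rightKL (v - ((m : Color) - (n : Color))) m n

/-- The vanishing ideal `I_e` of level `e`: the two-sided ideal of `T_∞` generated by all
`C^u_{m,n}` with `m + n = e + 1`. -/
noncomputable def vanishingIdeal (e : ℕ) : TwoSidedIdeal TInfty :=
  TwoSidedIdeal.span {x | ∃ (u : Color) (m n : ℕ), m + n = e + 1 ∧ x = rightKL u m n}

/-- The trihedral Hecke algebra `T_e = T_∞ / I_e` of level `e`. -/
abbrev TLevel (e : ℕ) : Type := TInfty ⧸ (vanishingIdeal e).asIdeal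

/-- The projection `T_∞ → T_e`. -/
noncomputable def proj (e : ℕ) : TInfty →ₐ[Cv] TLevel e :=
  Ideal.Quotient.mkₐ Cv (vanishingIdeal e).asIdeal

/-- The index set of the bases of `T_e`: `none` stands for the unit `1`, and `some (u, (m, n))`
for the Kazhdan–Lusztig element with colour `u` and indices `m + n ≤ e`. -/
abbrev BasisIndex (e : ℕ) : Type := Option (Color × {mn : ℕ × ℕ // mn.1 + mn.2 ≤ e})

/-- The family `1`, `C^u_{m,n}` (`m + n ≤ e`) in `T_e`. -/
noncomputable def rightFamily (e : ℕ) : BasisIndex e → TLevel e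
  | none => 1
  | some (u, mn) => proj e (rightKL u mn.1.1 mn.1.2)

/-- The family `1`, `^uC_{m,n}` (`m + n ≤ e`) in `T_e`. -/
noncomputable def leftFamily (e : ℕ) : BasisIndex e → TLevel e
  | none => 1
  | some (u, mn) => proj e (leftKL u mn.1.1 mn.1.2)

end Hecke

end Trihedral

/-!
The algebra `T_∞` is, up to its unit, an algebra of `3 × 3` matrices (rows and columns indexed by
the colours) over `ℂ(v)[X, Y]`: the monomial `h^u_{k,l}` corresponds to `[2]^{k+l} X^k Y^l` in
column `u` and row `u + k - l`, and left multiplication by `θ_w` multiplies an entry of row `w` by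
`[3]!`, of row `w - 1` by `[2] X` and of row `w + 1` by `[2] Y`. The element `C^u_{m,n}` thus
corresponds to the polynomial `U_{m,n}(X, Y)` that expresses `[L_{m,n}]` in terms of `[X]`, `[Y]`.
The Pieri rules `X U_{m,n} = U_{m+1,n} + U_{m-1,n+1} + U_{m,n-1}` and its mirror image
(`mul_schur_left`, `mul_schur_right`) give the products `θ_w C^u_{m,n}`. As the `C^u_{m,n}` with
`m + n = e + 1` die in `T_e`, the span of the family is a left ideal containing `1`, whence
`span_rightFamily`.

For independence, the Pieri rules truncated to the alcove `m + n ≤ e` define commuting operators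
`mulX`, `mulY` on `ℂ(v)^{alcove}`; they commute because at each point of the alcove the number of
admissible steps in the directions of the weights of `V` equals that for `V*`
(`mulX_mulY_comm`). There `U_{m,n}` sends the basis vector at the origin to the one at `(m, n)`, and
`U_{m,n} = 0` for `m + n = e + 1` (`evalOp_schur_delta`, `evalOp_schur_eq_zero`). The matrix
description then yields a representation of `T_e` that separates the elements of the family
(`rep`, `linearIndependent_rightFamily`).

The integers `d^{k,l}_{m,n}` have to be identified with the coefficients of `U_{m,n}`
(`dCoeff_eq_schur`). The module `L_{m,n}` lies in the kernel of the Laplacian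
`∑ ∂²/∂x_i∂y_i` and, together with the multiples of the invariant quadric `q = ∑ x_i y_i`, it spans
`Symᵐ(V) ⊗ Symⁿ(V*)`. So `Symᵐ V ⊗ Symⁿ V* = L_{m,n} ⊕ q · (Symᵐ⁻¹ V ⊗ Symⁿ⁻¹ V*)`, and the
character of `L_{m,n}` is `h_m(z) h_n(z⁻¹) - h_{m-1}(z) h_{n-1}(z⁻¹)` (`simpleClass_eq_schur`). The
recursion of the complete homogeneous polynomials turns this into a polynomial in the two
fundamental characters, which are algebraically independent by comparison of highest terms
(`evalChar_injective`).
-/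

namespace Trihedral

section SymmetricPowers

open MvPolynomial

/-! ### Derivations, the invariant quadric and the Laplacian -/

theorem derivation_sum_apply {ι : Type*} (s : Finset ι) (D : ι → Derivation ℂ SymPoly SymPoly)
    (p : SymPoly) : (∑ i ∈ s, D i) p = ∑ i ∈ s, D i p := by
  have h := map_sum (Derivation.coeFnAddMonoidHom (R := ℂ) (A := SymPoly) (M := SymPoly)) D s
  exact (congrFun h p).trans (Finset.sum_apply _ _ _)

/-- The derivation with `X i ↦ c i • X i`. The two degrees and the two weight coordinates of a
polynomial are all measured by such derivations. -/
noncomputable def diagDer (c : Fin 3 ⊕ Fin 3 → ℂ) : Derivation ℂ SymPoly SymPoly :=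
  mkDerivation ℂ fun i => c i • X i

theorem diagDer_X (c : Fin 3 ⊕ Fin 3 → ℂ) (i) : diagDer c (X i) = c i • X i :=
  mkDerivation_X _ _ _

theorem diagDer_monomial (c : Fin 3 ⊕ Fin 3 → ℂ) (s : Fin 3 ⊕ Fin 3 →₀ ℕ) (r : ℂ) :
    diagDer c (monomial s r) = (∑ i, (s i : ℂ) * c i) • monomial s r := by
  rw [diagDer, mkDerivation_monomial, Finsupp.sum_fintype _ _ (by simp), Finset.smul_sum,
    Finset.sum_smul]
  refine Finset.sum_congr rfl fun i _ => ?_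
  rcases Nat.eq_zero_or_pos (s i) with h | h
  · simp [h]
  · have hs : s - Finsupp.single i 1 + Finsupp.single i 1 = s :=
      tsub_add_cancel_of_le (Finsupp.single_le_iff.2 h)
    rw [X, smul_monomial, smul_eq_mul, smul_eq_mul, monomial_mul, hs, smul_monomial, smul_monomial]
    congr 1
    simp only [smul_eq_mul]; ring

theorem coeff_diagDer (c : Fin 3 ⊕ Fin 3 → ℂ) (p : SymPoly) (s : Fin 3 ⊕ Fin 3 →₀ ℕ) :
    coeff s (diagDer c p) = (∑ i, (s i : ℂ) * c i) * coeff s p := by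
  classical
  induction p using MvPolynomial.induction_on' with
  | monomial t r =>
    rw [diagDer_monomial, coeff_smul, coeff_monomial]
    split_ifs with h
    · rw [h, smul_eq_mul]
    · simp
  | add p q hp hq => rw [map_add, coeff_add, hp, hq, coeff_add, mul_add]

theorem diagDer_eq_smul_iff (c : Fin 3 ⊕ Fin 3 → ℂ) (a : ℂ) (p : SymPoly) :
    diagDer c p = a • p ↔ ∀ s ∈ p.support, ∑ i, (s i : ℂ) * c i = a := by
  rw [MvPolynomial.ext_iff]
  refine forall_congr' fun s => ?_
  rw [coeff_diagDer, coeff_smul, smul_eq_mul, mem_support_iff, mul_eq_mul_right_iff]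
  tauto

theorem pderiv_diagDer (c : Fin 3 ⊕ Fin 3 → ℂ) (i : Fin 3 ⊕ Fin 3) (p : SymPoly) :
    pderiv i (diagDer c p) = diagDer c (pderiv i p) + c i • pderiv i p := by
  have h : ⁅(pderiv i : Derivation ℂ SymPoly SymPoly), diagDer c⁆ = c i • (pderiv i : Derivation ℂ SymPoly SymPoly) := by
    apply derivation_ext
    intro j
    rw [Derivation.commutator_apply, diagDer_X, Derivation.map_smul, Derivation.smul_apply]
    by_cases hij : j = i
    · subst hij; simp
    · simp [pderiv_X_of_ne hij]
  rw [add_comm, ← Derivation.smul_apply, ← h, Derivation.commutator_apply]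
  abel

/-- The Laplacian `∑ ∂²/∂x_i∂y_i`, the contraction `Symᵐ V ⊗ Symⁿ V* → Symᵐ⁻¹ V ⊗ Symⁿ⁻¹ V*`. -/
noncomputable def lap : SymPoly →ₗ[ℂ] SymPoly :=
  ∑ i : Fin 3, (pderiv (Sum.inl i)).toLinearMap ∘ₗ (pderiv (Sum.inr i)).toLinearMap

theorem lap_apply (p : SymPoly) :
    lap p = ∑ i : Fin 3, pderiv (Sum.inl i) (pderiv (Sum.inr i) p) := by
  simp [lap]

/-- The invariant quadric `q = ∑ x_i y_i`. -/
noncomputable def quadric : SymPoly := ∑ i : Fin 3, X (Sum.inl i) * X (Sum.inr i)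

theorem quadric_ne_zero : quadric ≠ 0 := by
  intro h
  have := congrArg (eval fun _ => (1 : ℂ)) h
  simp [quadric] at this

theorem pderiv_inl_actDer (A : Matrix (Fin 3) (Fin 3) ℂ) (j : Fin 3) (p : SymPoly) :
    pderiv (Sum.inl j) (actDer A p) =
      actDer A (pderiv (Sum.inl j) p) + ∑ k, A j k • pderiv (Sum.inl k) p := by
  have h : ⁅(pderiv (Sum.inl j) : Derivation ℂ SymPoly SymPoly), actDer A⁆ =
      ∑ k, A j k • (pderiv (Sum.inl k) : Derivation ℂ SymPoly SymPoly) := by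
    apply derivation_ext
    rintro (i | i)
    · rw [Derivation.commutator_apply, actDer_inl]
      simp [pderiv_X, Pi.single_apply, derivation_sum_apply]
      fin_cases i <;> fin_cases j <;> simp
    · rw [Derivation.commutator_apply, actDer_inr]
      simp [pderiv_X, derivation_sum_apply]
  have := congrArg (fun D : Derivation ℂ SymPoly SymPoly => D p) h
  simp only [Derivation.commutator_apply, derivation_sum_apply,
    Derivation.smul_apply] at this
  rw [← this]; abel

theorem pderiv_inr_actDer (A : Matrix (Fin 3) (Fin 3) ℂ) (j : Fin 3) (p : SymPoly) :
    pderiv (Sum.inr j) (actDer A p) =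
      actDer A (pderiv (Sum.inr j) p) - ∑ k, A k j • pderiv (Sum.inr k) p := by
  have h : ⁅(pderiv (Sum.inr j) : Derivation ℂ SymPoly SymPoly), actDer A⁆ =
      -∑ k, A k j • (pderiv (Sum.inr k) : Derivation ℂ SymPoly SymPoly) := by
    apply derivation_ext
    rintro (i | i)
    · rw [Derivation.commutator_apply, actDer_inl]
      simp [pderiv_X, derivation_sum_apply]
    · rw [Derivation.commutator_apply, actDer_inr]
      simp [pderiv_X, Pi.single_apply, derivation_sum_apply]
      fin_cases i <;> fin_cases j <;> simp
  have := congrArg (fun D : Derivation ℂ SymPoly SymPoly => D p) h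
  simp only [Derivation.commutator_apply, derivation_sum_apply,
    Derivation.smul_apply, Derivation.neg_apply] at this
  rw [sub_eq_add_neg, ← this]; abel

theorem lap_actDer (A : Matrix (Fin 3) (Fin 3) ℂ) (p : SymPoly) :
    lap (actDer A p) = actDer A (lap p) := by
  simp only [lap_apply, pderiv_inr_actDer, map_sub, pderiv_inl_actDer, map_add,
    Derivation.map_smul, Fin.sum_univ_three]
  module

theorem actDer_quadric (A : Matrix (Fin 3) (Fin 3) ℂ) : actDer A quadric = 0 := by
  simp only [quadric, map_add, Derivation.leibniz, actDer_inl, actDer_inr, Fin.sum_univ_three,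
    smul_eq_mul, Algebra.smul_def]
  ring

theorem actDer_quadric_mul (A : Matrix (Fin 3) (Fin 3) ℂ) (p : SymPoly) :
    actDer A (quadric * p) = quadric * actDer A p := by
  rw [Derivation.leibniz, actDer_quadric, smul_zero, add_zero, smul_eq_mul]

/-- The degree in the variables `x_i`, as a system of eigenvalues for `diagDer`. -/
noncomputable def degX : Fin 3 ⊕ Fin 3 → ℂ := Sum.elim 1 0

/-- The degree in the variables `y_i`, as a system of eigenvalues for `diagDer`. -/
noncomputable def degY : Fin 3 ⊕ Fin 3 → ℂ := Sum.elim 0 1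

theorem diagDer_eq_sum (c : Fin 3 ⊕ Fin 3 → ℂ) (p : SymPoly) :
    diagDer c p = ∑ i, c i • (X i * pderiv i p) := by
  have h : diagDer c = ∑ i, c i • ((X i : SymPoly) • (pderiv i : Derivation ℂ SymPoly SymPoly)) := by
    apply derivation_ext
    rintro (j | j) <;>
    simp [diagDer_X, pderiv_X, derivation_sum_apply, Pi.single_apply]
  rw [h]
  simp [derivation_sum_apply]

/-- The commutation rule of the `sl₂`-triple formed by the Laplacian, multiplication by the quadric
and the total degree. -/
theorem lap_quadric_mul (p : SymPoly) :
    lap (quadric * p) = quadric * lap p + (3 : ℂ) • p + diagDer degX p + diagDer degY p := by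
  simp only [lap_apply, quadric, Fin.sum_univ_three, diagDer_eq_sum, Fintype.sum_sum_type,
    degX, degY, Sum.elim_inl, Sum.elim_inr, Derivation.leibniz, map_add, smul_eq_mul, pderiv_X,
    Pi.single_apply]
  simp [Algebra.smul_def, show (C (3 : ℂ) : SymPoly) = 3 from rfl]
  ring

theorem diagDer_lap (c : Fin 3 ⊕ Fin 3 → ℂ) (a : ℂ)
    (hc : ∀ i, c (Sum.inl i) + c (Sum.inr i) = a) (p : SymPoly) :
    diagDer c (lap p) = lap (diagDer c p) - a • lap p := by
  simp only [lap_apply, map_sum, pderiv_diagDer, map_add, Derivation.map_smul, Finset.smul_sum,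
    ← Finset.sum_sub_distrib]
  refine Finset.sum_congr rfl fun i _ => ?_
  rw [← hc i]
  module

theorem diagDer_quadric_mul (c : Fin 3 ⊕ Fin 3 → ℂ) (a : ℂ)
    (hc : ∀ i, c (Sum.inl i) + c (Sum.inr i) = a) (p : SymPoly) :
    diagDer c (quadric * p) = quadric * diagDer c p + a • (quadric * p) := by
  have h : diagDer c quadric = a • quadric := by
    simp only [quadric, map_sum, Derivation.leibniz, diagDer_X, Finset.smul_sum]
    refine Finset.sum_congr rfl fun i _ => ?_
    rw [← hc i]
    simp only [smul_eq_mul, Algebra.smul_def, map_add]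
    ring
  rw [Derivation.leibniz, h]
  simp only [smul_eq_mul, Algebra.smul_def]
  ring

theorem diagDer_actDer_comm (A : Matrix (Fin 3) (Fin 3) ℂ) (c : Fin 3 ⊕ Fin 3 → ℂ) (a b : ℂ)
    (ha : ∀ i, c (Sum.inl i) = a) (hb : ∀ i, c (Sum.inr i) = b) (p : SymPoly) :
    diagDer c (actDer A p) = actDer A (diagDer c p) := by
  have h : ⁅diagDer c, actDer A⁆ = 0 := by
    apply derivation_ext
    rintro (i | i)
    · rw [Derivation.commutator_apply, actDer_inl]
      simp [diagDer_X, Derivation.map_smul, actDer_inl, ha, Finset.smul_sum, smul_comm a]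
    · rw [Derivation.commutator_apply, actDer_inr]
      simp [diagDer_X, Derivation.map_smul, actDer_inr, hb, Finset.smul_sum, smul_comm b]
  rw [← sub_eq_zero, ← Derivation.commutator_apply, h, Derivation.zero_apply]

/-- The polynomials of bidegree `(i, j)` in `(x, y)`, that is `Symⁱ V ⊗ Symʲ V*`. The degrees are
complex numbers, being eigenvalues; in particular the piece is zero for `i = -1` or `j = -1`. -/
noncomputable def bidegree (i j : ℂ) : Submodule ℂ SymPoly :=
  Module.End.eigenspace (diagDer degX).toLinearMap i ⊓
    Module.End.eigenspace (diagDer degY).toLinearMap j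

theorem mem_bidegree {i j : ℂ} {p : SymPoly} :
    p ∈ bidegree i j ↔ diagDer degX p = i • p ∧ diagDer degY p = j • p := by
  simp [bidegree]

theorem mem_bidegree_iff_support (i j : ℂ) (p : SymPoly) : p ∈ bidegree i j ↔
    ∀ s ∈ p.support, ∑ k, (s (Sum.inl k) : ℂ) = i ∧ ∑ k, (s (Sum.inr k) : ℂ) = j := by
  rw [mem_bidegree, diagDer_eq_smul_iff, diagDer_eq_smul_iff, ← forall₂_and]
  simp [degX, degY, Fintype.sum_sum_type]

theorem lap_mem_bidegree {i j : ℂ} {p : SymPoly} (hp : p ∈ bidegree i j) :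
    lap p ∈ bidegree (i - 1) (j - 1) := by
  rw [mem_bidegree] at hp ⊢
  rw [diagDer_lap degX 1 (by simp [degX]), diagDer_lap degY 1 (by simp [degY]), hp.1, hp.2]
  simp [sub_smul]

theorem quadric_mul_mem_bidegree {i j : ℂ} {p : SymPoly} :
    quadric * p ∈ bidegree i j ↔ p ∈ bidegree (i - 1) (j - 1) := by
  rw [mem_bidegree, mem_bidegree,
    diagDer_quadric_mul degX 1 (by simp [degX]), diagDer_quadric_mul degY 1 (by simp [degY])]
  simp only [← eq_sub_iff_add_eq, ← sub_smul]
  rw [← mul_smul_comm, ← mul_smul_comm, mul_right_inj' quadric_ne_zero,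
    mul_right_inj' quadric_ne_zero]

/-- The operator `q Δ + c` with `c > 0` is injective on polynomials, where `Δ` is the Laplacian:
if `q Δ p + c p = 0`, then applying `Δ` gives an equation of the same shape for `Δ p`, with a larger
constant, in lower degree. The degrees are shifted by one so that the induction starts at the
vanishing piece of degree `-1`. -/
theorem eq_zero_of_quadric_mul_lap (k l c : ℕ) (p : SymPoly)
    (hp : p ∈ bidegree ((k : ℂ) - 1) ((l : ℂ) - 1))
    (h : quadric * lap p + ((c : ℂ) + 1) • p = 0) : p = 0 := by
  induction k generalizing l c p with
  | zero =>
    rw [← MvPolynomial.support_eq_empty, Finset.eq_empty_iff_forall_notMem]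
    intro s hs
    have h1 := ((mem_bidegree_iff_support _ _ _).1 hp s hs).1
    rw [eq_sub_iff_add_eq] at h1
    norm_cast at h1
  | succ k ih =>
    cases l with
    | zero =>
      rw [← MvPolynomial.support_eq_empty, Finset.eq_empty_iff_forall_notMem]
      intro s hs
      have h1 := ((mem_bidegree_iff_support _ _ _).1 hp s hs).2
      rw [eq_sub_iff_add_eq] at h1
      norm_cast at h1
    | succ l =>
      have hc : (c : ℂ) + 1 ≠ 0 := by norm_cast
      have hl := lap_mem_bidegree hp
      push_cast at hl
      rw [add_sub_cancel_right, add_sub_cancel_right] at hl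
      have hlap : lap p = 0 := by
        refine ih l (c + 1 + k + l) (lap p) hl ?_
        have h2 := congrArg lap h
        rw [map_add, lap_quadric_mul, map_smul, map_zero, (mem_bidegree.1 hl).1,
          (mem_bidegree.1 hl).2] at h2
        rw [← h2]
        push_cast
        module
      rw [hlap, mul_zero, zero_add] at h
      exact (smul_eq_zero.1 h).resolve_left hc

/-! ### Harmonic polynomials and the generation of `L_{m,n}` -/

theorem lie_eq_actDer (A : sl3) (p : SymPoly) : ⁅A, p⁆ = actDer A.1 p := rfl

/-- The harmonic polynomials of bidegree `(i, j)`. -/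
noncomputable def harmonic (i j : ℂ) : LieSubmodule ℂ sl3 SymPoly where
  toSubmodule := bidegree i j ⊓ LinearMap.ker lap
  lie_mem {A p} hp := by
    have h1 := mem_bidegree.1 hp.1
    refine ⟨mem_bidegree.2 ⟨?_, ?_⟩, ?_⟩
    · rw [lie_eq_actDer, diagDer_actDer_comm _ degX 1 0 (by simp [degX]) (by simp [degX]), h1.1,
        Derivation.map_smul]
    · rw [lie_eq_actDer, diagDer_actDer_comm _ degY 0 1 (by simp [degY]) (by simp [degY]), h1.2,
        Derivation.map_smul]
    · change lap ⁅A, p⁆ = 0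
      rw [lie_eq_actDer, lap_actDer, LinearMap.mem_ker.1 hp.2, map_zero]

theorem mem_harmonic {i j : ℂ} {p : SymPoly} :
    p ∈ harmonic i j ↔ p ∈ bidegree i j ∧ lap p = 0 := Iff.rfl

theorem simpleModule_le_harmonic (m n : ℕ) : simpleModule m n ≤ harmonic m n := by
  rw [simpleModule, LieSubmodule.lieSpan_le, Set.singleton_subset_iff]
  refine mem_harmonic.2 ⟨mem_bidegree.2 ⟨?_, ?_⟩, ?_⟩
  · cases m <;> simp [diagDer_X, degX, Derivation.leibniz, Derivation.leibniz_pow, Algebra.smul_def]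
    ring
  · cases n <;> simp [diagDer_X, degY, Derivation.leibniz, Derivation.leibniz_pow, Algebra.smul_def]
    ring
  · simp [lap_apply, Fin.sum_univ_three, Derivation.leibniz, Derivation.leibniz_pow, pderiv_X,
      Pi.single_apply]

theorem actDer_single (i j : Fin 3) (p : SymPoly) :
    actDer (Matrix.single i j 1) p =
      X (Sum.inl i) * pderiv (Sum.inl j) p - X (Sum.inr j) * pderiv (Sum.inr i) p := by
  have h : actDer (Matrix.single i j 1) =
      (X (Sum.inl i) : SymPoly) • (pderiv (Sum.inl j) : Derivation ℂ SymPoly SymPoly) -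
        (X (Sum.inr j) : SymPoly) • (pderiv (Sum.inr i) : Derivation ℂ SymPoly SymPoly) := by
    apply derivation_ext
    rintro (k | k)
    · simp [actDer_inl, Matrix.single_apply, pderiv_X, Pi.single_apply, ite_and, eq_comm]
    · simp [actDer_inr, Matrix.single_apply, pderiv_X, Pi.single_apply, ite_and, eq_comm]
  rw [h]; rfl

/-- The sum of `L_{m,n}` and the multiples of the invariant quadric. -/
noncomputable def simpleAddQuadric (m n : ℕ) : Submodule ℂ SymPoly :=
  (simpleModule m n).toSubmodule ⊔ LinearMap.range (LinearMap.mulLeft ℂ quadric)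

theorem quadric_mul_mem (m n : ℕ) (p : SymPoly) : quadric * p ∈ simpleAddQuadric m n :=
  Submodule.mem_sup_right ⟨p, rfl⟩

/-- The space `simpleAddQuadric` is stable under the matrix units `E_{ij}`, `i ≠ j`, which act as
`x_i ∂/∂x_j - y_j ∂/∂y_i`. -/
theorem raise_mem (m n : ℕ) {i j : Fin 3} (hij : i ≠ j) {p : SymPoly}
    (hp : p ∈ simpleAddQuadric m n) :
    X (Sum.inl i) * pderiv (Sum.inl j) p - X (Sum.inr j) * pderiv (Sum.inr i) p
      ∈ simpleAddQuadric m n := by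
  rw [← actDer_single]
  obtain ⟨s, hs, _, ⟨f, rfl⟩, rfl⟩ := Submodule.mem_sup.1 hp
  rw [map_add, LinearMap.mulLeft_apply, actDer_quadric_mul]
  refine add_mem (Submodule.mem_sup_left ?_) (quadric_mul_mem _ _ _)
  have hA : Matrix.single i j (1 : ℂ) ∈ sl3 :=
    (LinearMap.mem_ker).2 (by simp [Matrix.trace_single_eq_of_ne i j _ hij])
  exact (simpleModule m n).lie_mem (x := (⟨_, hA⟩ : sl3)) hs

/-- The monomial `x₀ᵃ x₁ᵇ x₂ᶜ y₀ᵈ y₁ᵉ y₂ᶠ`. -/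
noncomputable def mon (a b c d e f : ℕ) : SymPoly :=
  X (Sum.inl 0) ^ a * X (Sum.inl 1) ^ b * X (Sum.inl 2) ^ c *
    (X (Sum.inr 0) ^ d * X (Sum.inr 1) ^ e * X (Sum.inr 2) ^ f)

theorem mon_raise_x₀_x₁ {m n a b c d f : ℕ} (h : mon (a + 1) b c d 0 f ∈ simpleAddQuadric m n) :
    mon a (b + 1) c d 0 f ∈ simpleAddQuadric m n := by
  have h1 := raise_mem m n (show (1 : Fin 3) ≠ 0 by decide) h
  rw [← Submodule.smul_mem_iff _ (show ((a : ℂ) + 1) ≠ 0 by norm_cast)]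
  convert h1 using 1
  simp [mon, Derivation.leibniz, Derivation.leibniz_pow, pderiv_X,
    Algebra.smul_def]
  ring

theorem mon_raise_y₂_y₁ {m n a c d e f : ℕ} (h : mon a 0 c d e (f + 1) ∈ simpleAddQuadric m n) :
    mon a 0 c d (e + 1) f ∈ simpleAddQuadric m n := by
  have h1 := raise_mem m n (show (2 : Fin 3) ≠ 1 by decide) h
  rw [← Submodule.smul_mem_iff _ (show -((f : ℂ) + 1) ≠ 0 from neg_ne_zero.2 (by norm_cast))]
  convert h1 using 1
  simp [mon, Derivation.leibniz, Derivation.leibniz_pow, pderiv_X,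
    Algebra.smul_def]
  ring

theorem mon_reduce_x₁_y₁ {m n a b c d e f : ℕ} (h : mon (a + 1) b c (d + 1) e f ∈ simpleAddQuadric m n)
    (h' : mon a b (c + 1) d e (f + 1) ∈ simpleAddQuadric m n) :
    mon a (b + 1) c d (e + 1) f ∈ simpleAddQuadric m n := by
  convert sub_mem (sub_mem (quadric_mul_mem m n (mon a b c d e f)) h) h' using 1
  simp only [mon, quadric, Fin.sum_univ_three]
  ring

theorem mon_raise_y₂_y₀_of_zero {m n b c d f : ℕ} (h : mon 0 b c d 0 (f + 1) ∈ simpleAddQuadric m n) :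
    mon 0 b c (d + 1) 0 f ∈ simpleAddQuadric m n := by
  have h1 := raise_mem m n (show (2 : Fin 3) ≠ 0 by decide) h
  rw [← Submodule.smul_mem_iff _ (show -((f : ℂ) + 1) ≠ 0 from neg_ne_zero.2 (by norm_cast))]
  convert h1 using 1
  simp [mon, Derivation.leibniz, Derivation.leibniz_pow, pderiv_X,
    Algebra.smul_def]
  ring

/-- Modulo the quadric, the sum of `E_{20}` and `E_{21} E_{10}` sends this monomial to a positive
multiple of the desired one, the terms in which `y₂` is replaced by `y₀` cancelling. -/
theorem mon_raise_x₀_x₂ {m n a b c d f : ℕ} (h : mon (a + 1) b c d 0 f ∈ simpleAddQuadric m n) :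
    mon a b (c + 1) d 0 f ∈ simpleAddQuadric m n := by
  have h1 := raise_mem m n (show (2 : Fin 3) ≠ 0 by decide) h
  have h2 := raise_mem m n (show (2 : Fin 3) ≠ 1 by decide) (mon_raise_x₀_x₁ h)
  have hne : (a : ℂ) + b + f + 1 + 1 ≠ 0 := by norm_cast
  rw [← Submodule.smul_mem_iff _ hne]
  cases f with
  | zero =>
    convert add_mem h1 h2 using 1
    simp [mon, Derivation.leibniz, Derivation.leibniz_pow, pderiv_X,
      Algebra.smul_def]
    ring
  | succ f =>
    -- The factor `x₁ y₁` produced by `E_{21}` is removed by means of the quadric.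
    convert add_mem (add_mem h1 h2)
      (Submodule.smul_mem _ ((f : ℂ) + 1) (quadric_mul_mem m n (mon a b c d 0 f))) using 1
    simp [mon, Derivation.leibniz, Derivation.leibniz_pow, pderiv_X,
      Algebra.smul_def, quadric, Fin.sum_univ_three]
    ring

theorem mon_raise_y₂_y₀ {m n a b c d f : ℕ} (h : mon a b c d 0 (f + 1) ∈ simpleAddQuadric m n) :
    mon a b c (d + 1) 0 f ∈ simpleAddQuadric m n := by
  cases a with
  | zero => exact mon_raise_y₂_y₀_of_zero h
  | succ a =>
    have h1 := raise_mem m n (show (2 : Fin 3) ≠ 0 by decide) h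
    have h2 := Submodule.smul_mem _ ((a : ℂ) + 1) (mon_raise_x₀_x₂ h)
    rw [← Submodule.smul_mem_iff _ (show -((f : ℂ) + 1) ≠ 0 from neg_ne_zero.2 (by norm_cast))]
    convert sub_mem h1 h2 using 1
    simp [mon, Derivation.leibniz, Derivation.leibniz_pow, pderiv_X,
      Algebra.smul_def]
    ring

theorem mon_mem_of_zero {m n : ℕ} (b c d a f : ℕ) (h1 : a + b + c = m) (h2 : d + f = n) :
    mon a b c d 0 f ∈ simpleAddQuadric m n := by
  induction b generalizing a with
  | succ b ih => exact mon_raise_x₀_x₁ (ih (a + 1) (by omega))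
  | zero =>
    induction c generalizing a with
    | succ c ih => exact mon_raise_x₀_x₂ (ih (a + 1) (by omega))
    | zero =>
      induction d generalizing f with
      | succ d ih => exact mon_raise_y₂_y₀ (ih (f + 1) (by omega))
      | zero =>
        refine Submodule.mem_sup_left (LieSubmodule.subset_lieSpan ?_)
        obtain rfl : a = m := by omega
        obtain rfl : f = n := by omega
        simp [mon]

/-- All monomials of bidegree `(m, n)` are reached from `x₀ᵐ y₂ⁿ`: those without `y₁` or without `x₁`
by raising operators, the others by eliminating `x₁ y₁` by means of the quadric. -/
theorem mon_mem {m n : ℕ} (a b c d e f : ℕ) (h1 : a + b + c = m) (h2 : d + e + f = n) :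
    mon a b c d e f ∈ simpleAddQuadric m n := by
  induction b generalizing a c d e f with
  | zero =>
    induction e generalizing f with
    | zero => exact mon_mem_of_zero 0 c d a f h1 h2
    | succ e ih => exact mon_raise_y₂_y₁ (ih (f + 1) (by omega))
  | succ b ih =>
    cases e with
    | zero => exact mon_mem_of_zero (b + 1) c d a f h1 h2
    | succ e =>
      exact mon_reduce_x₁_y₁ (ih _ _ _ _ _ (by omega) (by omega)) (ih _ _ _ _ _ (by omega) (by omega))

theorem bidegree_le_simpleAddQuadric (m n : ℕ) : bidegree m n ≤ simpleAddQuadric m n := by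
  intro p hp
  rw [mem_bidegree_iff_support] at hp
  rw [p.as_sum]
  refine sum_mem fun s hs => ?_
  obtain ⟨h1, h2⟩ := hp s hs
  rw [Fin.sum_univ_three] at h1 h2
  have h := Submodule.smul_mem _ (coeff s p) (mon_mem (m := m) (n := n) (s (Sum.inl 0))
    (s (Sum.inl 1)) (s (Sum.inl 2)) (s (Sum.inr 0)) (s (Sum.inr 1)) (s (Sum.inr 2))
    (by exact_mod_cast h1) (by exact_mod_cast h2))
  convert h using 1
  rw [monomial_eq, Finsupp.prod_fintype _ _ (by simp)]
  simp [mon, Fin.prod_univ_three, smul_eq_C_mul]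

/-- One half of the decomposition `Symᵐ V ⊗ Symⁿ V* = L_{m,n} ⊕ q · (Symᵐ⁻¹ V ⊗ Symⁿ⁻¹ V*)`. -/
theorem exists_add_quadric_mul (m n : ℕ) {p : SymPoly} (hp : p ∈ bidegree m n) :
    ∃ s ∈ simpleModule m n, ∃ f ∈ bidegree ((m : ℂ) - 1) ((n : ℂ) - 1), s + quadric * f = p := by
  obtain ⟨s, hs, _, ⟨f, rfl⟩, h⟩ := Submodule.mem_sup.1 (bidegree_le_simpleAddQuadric m n hp)
  rw [LinearMap.mulLeft_apply] at h
  refine ⟨s, hs, f, ?_, h⟩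
  rw [← quadric_mul_mem_bidegree, eq_sub_of_add_eq' h]
  exact sub_mem hp (simpleModule_le_harmonic m n hs).1

/-- The other half of the decomposition `Symᵐ V ⊗ Symⁿ V* = L_{m,n} ⊕ q · (Symᵐ⁻¹ V ⊗ Symⁿ⁻¹ V*)`. -/
theorem eq_zero_of_add_quadric_mul (m n : ℕ) {s f : SymPoly} (hs : s ∈ simpleModule m n)
    (hf : f ∈ bidegree ((m : ℂ) - 1) ((n : ℂ) - 1)) (h : s + quadric * f = 0) : s = 0 ∧ f = 0 := by
  have hf0 : f = 0 := by
    refine eq_zero_of_quadric_mul_lap m n (m + n) f hf ?_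
    have h1 := congrArg lap h
    rw [map_add, (simpleModule_le_harmonic m n hs).2, lap_quadric_mul, map_zero,
      (mem_bidegree.1 hf).1, (mem_bidegree.1 hf).2] at h1
    rw [← h1]
    push_cast
    module
  rw [hf0, mul_zero, add_zero] at h
  exact ⟨h, hf0⟩

/-! ### Weight multiplicities of `L_{m,n}` -/

theorem mem_weightSpace {M : Type*} [AddCommGroup M] [Module ℂ M] [LieRingModule sl3 M]
    [LieModule ℂ sl3 M] {μ : ℤ × ℤ} {v : M} :
    v ∈ weightSpace M μ ↔ ⁅coroot₁, v⁆ = (μ.1 : ℂ) • v ∧ ⁅coroot₂, v⁆ = (μ.2 : ℂ) • v := by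
  simp [weightSpace]

/-- The weight space of weight `μ` in `Symⁱ V ⊗ Symʲ V*`. -/
noncomputable def bidegreeWeight (i j : ℂ) (μ : ℤ × ℤ) : Submodule ℂ SymPoly :=
  bidegree i j ⊓ weightSpace SymPoly μ

theorem quadric_mul_mem_weightSpace {μ : ℤ × ℤ} {p : SymPoly} :
    quadric * p ∈ weightSpace SymPoly μ ↔ p ∈ weightSpace SymPoly μ := by
  simp only [mem_weightSpace, lie_eq_actDer, actDer_quadric_mul, ← mul_smul_comm,
    mul_right_inj' quadric_ne_zero]

theorem mem_weightSpace_of_add_quadric_mul (m n : ℕ) {μ : ℤ × ℤ} {s f : SymPoly}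
    (hs : s ∈ simpleModule m n) (hf : f ∈ bidegree ((m : ℂ) - 1) ((n : ℂ) - 1))
    (h : s + quadric * f ∈ weightSpace SymPoly μ) :
    s ∈ weightSpace SymPoly μ ∧ f ∈ weightSpace SymPoly μ := by
  have key : ∀ (A : sl3) (a : ℂ), ⁅A, s + quadric * f⁆ = a • (s + quadric * f) →
      ⁅A, s⁆ = a • s ∧ ⁅A, f⁆ = a • f := by
    intro A a hA
    rw [← sub_eq_zero, ← sub_eq_zero (a := ⁅A, f⁆)]
    refine eq_zero_of_add_quadric_mul m n
      (sub_mem ((simpleModule m n).lie_mem hs) (Submodule.smul_mem _ _ hs))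
      (sub_mem ?_ (Submodule.smul_mem _ _ hf)) ?_
    · rw [mem_bidegree] at hf ⊢
      rw [lie_eq_actDer, diagDer_actDer_comm _ degX 1 0 (by simp [degX]) (by simp [degX]), hf.1,
        diagDer_actDer_comm _ degY 0 1 (by simp [degY]) (by simp [degY]), hf.2,
        Derivation.map_smul, Derivation.map_smul]
      exact ⟨rfl, rfl⟩
    · rw [lie_add, smul_add, lie_eq_actDer A (quadric * f), actDer_quadric_mul,
        ← lie_eq_actDer] at hA
      rw [mul_sub, mul_smul_comm, sub_add_sub_comm, hA, sub_self]
  rw [mem_weightSpace] at h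
  have h1 := key _ _ h.1
  have h2 := key _ _ h.2
  exact ⟨mem_weightSpace.2 ⟨h1.1, h2.1⟩, mem_weightSpace.2 ⟨h1.2, h2.2⟩⟩

theorem finrank_weightSpace_simpleModule (m n : ℕ) (μ : ℤ × ℤ)
    [FiniteDimensional ℂ (bidegreeWeight m n μ)] :
    Module.finrank ℂ (weightSpace (simpleModule m n) μ) +
      Module.finrank ℂ (bidegreeWeight ((m : ℂ) - 1) ((n : ℂ) - 1) μ) =
        Module.finrank ℂ (bidegreeWeight m n μ) := by
  set A := (weightSpace (simpleModule m n) μ).map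
    ((simpleModule m n).incl : simpleModule m n →ₗ[ℂ] SymPoly) with hA
  set B := (bidegreeWeight ((m : ℂ) - 1) ((n : ℂ) - 1) μ).map (LinearMap.mulLeft ℂ quadric) with hB
  have hmemA : ∀ s, s ∈ A ↔ s ∈ simpleModule m n ∧ s ∈ weightSpace SymPoly μ := by
    intro s
    rw [hA, Submodule.mem_map]
    constructor
    · rintro ⟨⟨t, ht⟩, h, rfl⟩
      replace h := mem_weightSpace.1 h
      refine ⟨ht, mem_weightSpace.2 ⟨?_, ?_⟩⟩
      · exact congrArg Subtype.val h.1
      · exact congrArg Subtype.val h.2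
    · rintro ⟨hs, h⟩
      rw [mem_weightSpace] at h
      exact ⟨⟨s, hs⟩, mem_weightSpace.2 ⟨Subtype.ext h.1, Subtype.ext h.2⟩, rfl⟩
  have h1 : Module.finrank ℂ A = Module.finrank ℂ (weightSpace (simpleModule m n) μ) :=
    (Submodule.equivMapOfInjective _ Subtype.val_injective _).finrank_eq.symm
  have h2 : Module.finrank ℂ B =
      Module.finrank ℂ (bidegreeWeight ((m : ℂ) - 1) ((n : ℂ) - 1) μ) :=
    (Submodule.equivMapOfInjective _ (mul_right_injective₀ quadric_ne_zero) _).finrank_eq.symm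
  have hsup : A ⊔ B = bidegreeWeight m n μ := by
    apply le_antisymm
    · refine sup_le (fun s hs => ?_) ?_
      · obtain ⟨hs, hw⟩ := (hmemA s).1 hs
        exact ⟨(simpleModule_le_harmonic m n hs).1, hw⟩
      · rintro _ ⟨f, hf, rfl⟩
        exact ⟨quadric_mul_mem_bidegree.2 hf.1, quadric_mul_mem_weightSpace.2 hf.2⟩
    · rintro p ⟨hp, hw⟩
      obtain ⟨s, hs, f, hf, rfl⟩ := exists_add_quadric_mul m n hp
      have h := mem_weightSpace_of_add_quadric_mul m n hs hf hw
      exact Submodule.add_mem_sup ((hmemA s).2 ⟨hs, h.1⟩) ⟨f, ⟨hf, h.2⟩, rfl⟩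
  have hinf : A ⊓ B = ⊥ := by
    rw [Submodule.eq_bot_iff]
    rintro s ⟨hs, f, hf, hsf⟩
    refine (eq_zero_of_add_quadric_mul m n (f := -f) ((hmemA s).1 hs).1 (neg_mem hf.1) ?_).1
    rw [← hsf, LinearMap.mulLeft_apply, mul_neg, add_neg_cancel]
  have : FiniteDimensional ℂ A :=
    Submodule.finiteDimensional_of_le (le_sup_left.trans_eq hsup)
  have : FiniteDimensional ℂ B :=
    Submodule.finiteDimensional_of_le (le_sup_right.trans_eq hsup)
  have h := Submodule.finrank_sup_add_finrank_inf_eq A B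
  rw [hsup, hinf, finrank_bot, h1, h2] at h
  exact h.symm

/-- The weight of `x_i`, in the basis of fundamental weights. -/
def epsWeight : Fin 3 → ℤ × ℤ := ![(1, 0), (-1, 1), (0, -1)]

/-- The exponents of the monomials of bidegree `(i, j)` and weight `μ`. The degrees are integers so
that `-1` is allowed, for which there are none. -/
def exponents (i j : ℤ) (μ : ℤ × ℤ) : Set (Fin 3 ⊕ Fin 3 →₀ ℕ) :=
  {s | ∑ k, (s (Sum.inl k) : ℤ) = i ∧ ∑ k, (s (Sum.inr k) : ℤ) = j ∧
    ∑ k, (s (Sum.inl k) : ℤ) • epsWeight k - ∑ k, (s (Sum.inr k) : ℤ) • epsWeight k = μ}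

theorem actDer_diagonal (t : Fin 3 → ℂ) :
    actDer (Matrix.diagonal t) = diagDer (Sum.elim t (-t)) := by
  apply derivation_ext
  rintro (k | k)
  · simp [actDer_inl, diagDer_X, Matrix.diagonal_apply]
  · simp [actDer_inr, diagDer_X, Matrix.diagonal_apply]

theorem bidegreeWeight_eq (i j : ℤ) (μ : ℤ × ℤ) :
    bidegreeWeight i j μ = restrictSupport ℂ (exponents i j μ) := by
  ext p
  rw [mem_restrictSupport_iff, bidegreeWeight, Submodule.mem_inf, mem_bidegree_iff_support, mem_weightSpace,
    lie_eq_actDer, lie_eq_actDer, coroot₁, coroot₂, actDer_diagonal, actDer_diagonal,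
    diagDer_eq_smul_iff, diagDer_eq_smul_iff, ← forall₂_and, ← forall₂_and]
  refine forall₂_congr fun s _ => ?_
  rw [exponents, Set.mem_ofPred_eq, and_assoc]
  refine and_congr (by norm_cast) (and_congr (by norm_cast) ?_)
  rw [Prod.ext_iff]
  simp only [Fintype.sum_sum_type, Fin.sum_univ_three, epsWeight]
  refine and_congr ?_ ?_
  · rw [← Int.cast_inj (α := ℂ)]
    simp [sub_eq_add_neg]
    ring_nf
  · rw [← Int.cast_inj (α := ℂ)]
    simp [sub_eq_add_neg]
    ring_nf

theorem finrank_bidegreeWeight (i j : ℤ) (μ : ℤ × ℤ) :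
    Module.finrank ℂ (bidegreeWeight i j μ) = (exponents i j μ).ncard := by
  rw [bidegreeWeight_eq, Module.finrank_eq_nat_card_basis (basisRestrictSupport ℂ _),
    Nat.card_coe_set_eq]

theorem exponents_eq (a b : ℕ) (μ : ℤ × ℤ) :
    exponents a b μ = Finsupp.sumFinsuppEquivProdFinsupp.symm ''
      (((Finset.univ.finsuppAntidiag a ×ˢ Finset.univ.finsuppAntidiag b).filter
        fun l : (Fin 3 →₀ ℕ) × (Fin 3 →₀ ℕ) =>
          ∑ k, (l.1 k : ℤ) • epsWeight k - ∑ k, (l.2 k : ℤ) • epsWeight k = μ : Finset _) :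
          Set ((Fin 3 →₀ ℕ) × (Fin 3 →₀ ℕ))) := by
  ext s
  rw [Equiv.image_symm_eq_preimage, Set.mem_preimage, Finset.mem_coe, Finset.mem_filter,
    Finset.mem_product, Finset.mem_finsuppAntidiag, Finset.mem_finsuppAntidiag, exponents,
    Set.mem_ofPred_eq]
  simp only [Finsupp.fst_sumFinsuppEquivProdFinsupp, Finsupp.snd_sumFinsuppEquivProdFinsupp,
    Finset.subset_univ, and_true, and_assoc]
  refine and_congr (by norm_cast) (and_congr (by norm_cast) Iff.rfl)

theorem exponents_neg_left (j : ℤ) (μ : ℤ × ℤ) : exponents (-1) j μ = ∅ := by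
  refine Set.eq_empty_of_forall_notMem fun s hs => ?_
  have h := hs.1
  norm_cast at h

theorem exponents_neg_right (i : ℤ) (μ : ℤ × ℤ) : exponents i (-1) μ = ∅ := by
  refine Set.eq_empty_of_forall_notMem fun s hs => ?_
  have h := hs.2.1
  norm_cast at h

theorem finrank_weightSpace_eq_ncard (m n : ℕ) (μ : ℤ × ℤ) :
    (Module.finrank ℂ (weightSpace (simpleModule m n) μ) : ℤ) =
      (exponents m n μ).ncard - (exponents (m - 1) (n - 1) μ).ncard := by
  have hf : (exponents m n μ).Finite := by
    rw [exponents_eq]; exact (Finset.finite_toSet _).image _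
  have : FiniteDimensional ℂ (bidegreeWeight m n μ) := by
    have := hf.fintype
    rw [show bidegreeWeight m n μ = _ from bidegreeWeight_eq m n μ]
    exact Module.Basis.finiteDimensional_of_finite (basisRestrictSupport ℂ _)
  have h := finrank_weightSpace_simpleModule m n μ
  have h1 := finrank_bidegreeWeight m n μ
  have h2 := finrank_bidegreeWeight (m - 1) (n - 1) μ
  rw [Int.cast_natCast, Int.cast_natCast] at h1
  rw [Int.cast_sub, Int.cast_sub, Int.cast_natCast, Int.cast_natCast, Int.cast_one] at h2
  rw [h1, h2] at h
  rw [← h]; push_cast; ring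

end SymmetricPowers

/-! ### Schur polynomials of `sl₃` in the two fundamental characters -/

section Schur

/-- The complete homogeneous symmetric polynomial `h_{n-2}` in three variables with product `1`, as a
polynomial in `x = e₁` and `y = e₂`. The index is shifted by two because the recursion, which has
order three, needs the values `h_{-2} = h_{-1} = 0`. -/
def completeSeq {R : Type*} [CommRing R] (x y : R) : ℕ → R
  | 0 => 0
  | 1 => 0
  | 2 => 1
  | n + 3 => x * completeSeq x y (n + 2) - y * completeSeq x y (n + 1) + completeSeq x y n

/-- The Schur polynomial `U_{a-1,b-1} = h_{a-1} h*_{b-1} - h_{a-2} h*_{b-2}` in the fundamental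
characters `x` and `y`, where `h*` arises from `h` by interchanging `x` and `y`. The index `(a, b)` is
the highest weight shifted by `ρ`, so that `schur` vanishes on the walls `a = 0` and `b = 0` and the
Pieri rules hold without exception. -/
def schur {R : Type*} [CommRing R] (x y : R) (a b : ℕ) : R :=
  completeSeq x y (a + 1) * completeSeq y x (b + 1) - completeSeq x y a * completeSeq y x b

variable {R : Type*} [CommRing R] (x y : R)

theorem schur_zero_left (b : ℕ) : schur x y 0 b = 0 := by simp [schur, completeSeq]

theorem schur_zero_right (a : ℕ) : schur x y a 0 = 0 := by simp [schur, completeSeq]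

theorem schur_one_one : schur x y 1 1 = 1 := by simp [schur, completeSeq]

theorem schur_two_one : schur x y 2 1 = x := by simp [schur, completeSeq]

theorem schur_one_two : schur x y 1 2 = y := by simp [schur, completeSeq]

theorem mul_schur_left (a b : ℕ) : x * schur x y (a + 1) (b + 1) =
    schur x y (a + 2) (b + 1) + schur x y a (b + 2) + schur x y (a + 1) b := by
  simp only [schur, completeSeq]; ring

theorem mul_schur_right (a b : ℕ) : y * schur x y (a + 1) (b + 1) =
    schur x y (a + 1) (b + 2) + schur x y (a + 2) b + schur x y a (b + 1) := by
  simp only [schur, completeSeq]; ring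

theorem map_schur {S : Type*} [CommRing S] (f : R →+* S) (a b : ℕ) :
    f (schur x y a b) = schur (f x) (f y) a b := by
  have h : ∀ (x y : R) (n : ℕ), f (completeSeq x y n) = completeSeq (f x) (f y) n := by
    intro x y n
    induction n using completeSeq.induct with
    | case1 => simp [completeSeq]
    | case2 => simp [completeSeq]
    | case3 => simp [completeSeq]
    | case4 n h1 h2 h3 => simp [completeSeq, h1, h2, h3]
  simp [schur, h]

/-- Induction along the Pieri rules: each Schur polynomial is obtained from ones with a smaller value
of `a + b`. -/
theorem schur_induction (P : ℕ → ℕ → Prop) (zero_left : ∀ b, P 0 b) (zero_right : ∀ a, P a 0)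
    (one_one : P 1 1)
    (left : ∀ a b, P (a + 1) (b + 1) → P a (b + 2) → P (a + 1) b → P (a + 2) (b + 1))
    (right : ∀ a b, P (a + 1) (b + 1) → P (a + 2) b → P a (b + 1) → P (a + 1) (b + 2))
    (a b : ℕ) : P a b := by
  obtain ⟨N, hN⟩ : ∃ N, a + b = N := ⟨_, rfl⟩
  induction N using Nat.strong_induction_on generalizing a b with
  | _ N ih =>
    have ih' : ∀ a b, a + b < N → P a b := fun a b hab => ih _ hab a b rfl
    rcases a with _ | _ | a
    · exact zero_left b
    · rcases b with _ | _ | b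
      · exact zero_right _
      · exact one_one
      · exact right 0 b (ih' _ _ (by omega)) (ih' _ _ (by omega)) (zero_left _)
    · rcases b with _ | b
      · exact zero_right _
      · exact left a b (ih' _ _ (by omega)) (ih' _ _ (by omega)) (ih' _ _ (by omega))

end Schur

/-! ### The characters of the simple modules -/

section Character

/-- The group ring of the weight lattice. -/
abbrev WeightRing : Type := AddMonoidAlgebra ℤ (ℤ × ℤ)

/-- The weight of `x_i` as an element `z_i` of the group ring. -/
noncomputable def zVar (i : Fin 3) : WeightRing := AddMonoidAlgebra.single (epsWeight i) 1

/-- The inverse `z_i⁻¹`, the weight of `y_i`. -/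
noncomputable def zInv (i : Fin 3) : WeightRing := AddMonoidAlgebra.single (-epsWeight i) 1

/-- The character `z₀ + z₁ + z₂` of `V`. -/
noncomputable def charX : WeightRing := ∑ i, zVar i

/-- The character `z₀⁻¹ + z₁⁻¹ + z₂⁻¹` of `V*`. -/
noncomputable def charY : WeightRing := ∑ i, zInv i

open PowerSeries in
/-- The product of the geometric series `∑ z_iⁿ tⁿ` is inverse to
`∏ (1 - z_i t) = 1 - e₁ t + e₂ t² - t³`, which is the recursion of `completeSeq`. -/
theorem sum_finsuppAntidiag_eq_completeSeq {R : Type*} [CommRing R] (z : Fin 3 → R)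
    (h : z 0 * z 1 * z 2 = 1) (n : ℕ) :
    ∑ l ∈ (Finset.univ : Finset (Fin 3)).finsuppAntidiag n, ∏ i, z i ^ l i =
      completeSeq (∑ i, z i) (z 0 * z 1 + z 0 * z 2 + z 1 * z 2) (n + 2) := by
  have hgeom : ∀ a : R, (1 - C a * X) * PowerSeries.mk (fun n => a ^ n) = 1 := by
    intro a
    ext n
    cases n with
    | zero => simp [sub_mul]
    | succ n => simp [sub_mul, mul_assoc, coeff_succ_X_mul, pow_succ', coeff_one]
  set F : PowerSeries R := X ^ 2 * ∏ i : Fin 3, PowerSeries.mk (fun n => z i ^ n) with hF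
  have hprod : (1 - C (∑ i, z i) * X + C (z 0 * z 1 + z 0 * z 2 + z 1 * z 2) * X ^ 2 - X ^ 3) * F
      = X ^ 2 := by
    have h3 : (X ^ 3 : PowerSeries R) = C (z 0 * z 1 * z 2) * X ^ 3 := by rw [h]; simp
    have hz : (∏ i : Fin 3, ((1 - C (z i) * X) * PowerSeries.mk (fun n => z i ^ n))) = 1 :=
      Finset.prod_eq_one fun i _ => hgeom _
    calc _ = X ^ 2 * ∏ i : Fin 3, ((1 - C (z i) * X) * PowerSeries.mk (fun n => z i ^ n)) := by
          rw [h3, hF]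
          simp only [Fin.prod_univ_three, Fin.sum_univ_three, map_add, map_mul]
          ring
      _ = X ^ 2 := by rw [hz, mul_one]
  have hF0 : ∀ n < 2, coeff n F = 0 := by
    intro n hn
    rw [hF, coeff_X_pow_mul', if_neg (by omega)]
  have key : ∀ n, coeff n F =
      completeSeq (∑ i, z i) (z 0 * z 1 + z 0 * z 2 + z 1 * z 2) n := by
    intro n
    induction n using completeSeq.induct with
    | case1 => simp [completeSeq, hF0]
    | case2 => simp [completeSeq, hF0]
    | case3 =>
      have := congrArg (coeff 2) hprod
      simp [sub_mul, add_mul, mul_assoc, coeff_X_pow_mul', coeff_X_pow, coeff_succ_X_mul,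
        hF0, -map_sum, -coeff_zero_eq_constantCoeff] at this
      simpa [completeSeq] using this
    | case4 n h1 h2 h3 =>
      have := congrArg (coeff (n + 3)) hprod
      simp [sub_mul, add_mul, mul_assoc, coeff_X_pow_mul', coeff_X_pow, coeff_succ_X_mul,
        -map_sum, h1, h2, h3] at this
      rw [completeSeq]
      linear_combination this
  rw [← key, hF, coeff_X_pow_mul, coeff_prod]
  simp

/-- The complete homogeneous symmetric polynomial of degree `n` in `z₀, z₁, z₂`. -/
noncomputable def completeChar (z : Fin 3 → WeightRing) (n : ℕ) : WeightRing :=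
  ∑ l ∈ (Finset.univ : Finset (Fin 3)).finsuppAntidiag n, ∏ i, z i ^ l i

theorem prod_zVar_pow (l : Fin 3 →₀ ℕ) :
    ∏ i, zVar i ^ l i = AddMonoidAlgebra.single (∑ k, (l k : ℤ) • epsWeight k) 1 := by
  simp only [zVar, AddMonoidAlgebra.single_pow, one_pow, Fin.prod_univ_three, Fin.sum_univ_three,
    AddMonoidAlgebra.single_mul_single, mul_one, natCast_zsmul]

theorem prod_zInv_pow (l : Fin 3 →₀ ℕ) :
    ∏ i, zInv i ^ l i = AddMonoidAlgebra.single (-∑ k, (l k : ℤ) • epsWeight k) 1 := by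
  simp only [zInv, AddMonoidAlgebra.single_pow, one_pow, Fin.prod_univ_three, Fin.sum_univ_three,
    AddMonoidAlgebra.single_mul_single, mul_one, natCast_zsmul, smul_neg, neg_add]

theorem completeChar_zVar (n : ℕ) : completeChar zVar n = completeSeq charX charY (n + 2) := by
  rw [completeChar, sum_finsuppAntidiag_eq_completeSeq, charX, charY]
  · congr 1
    simp [zVar, zInv, AddMonoidAlgebra.single_mul_single, epsWeight, Fin.sum_univ_three]
    abel
  · simp [zVar, AddMonoidAlgebra.single_mul_single, epsWeight, AddMonoidAlgebra.one_def,
      Prod.mk_zero_zero]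

theorem completeChar_zInv (n : ℕ) : completeChar zInv n = completeSeq charY charX (n + 2) := by
  rw [completeChar, sum_finsuppAntidiag_eq_completeSeq, charX, charY]
  · congr 1
    simp [zVar, zInv, AddMonoidAlgebra.single_mul_single, epsWeight, Fin.sum_univ_three]
    abel
  · simp [zInv, AddMonoidAlgebra.single_mul_single, epsWeight, AddMonoidAlgebra.one_def,
      Prod.mk_zero_zero]

theorem coeff_completeChar_mul (a b : ℕ) (μ : ℤ × ℤ) :
    (completeChar zVar a * completeChar zInv b).coeff μ = (exponents a b μ).ncard := by
  rw [exponents_eq, Set.ncard_image_of_injective _ (Equiv.injective _), Set.ncard_coe_finset,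
    completeChar, completeChar, Finset.sum_mul_sum, ← Finset.sum_product', Finset.card_filter]
  simp only [prod_zVar_pow, prod_zInv_pow, AddMonoidAlgebra.single_mul_single, mul_one,
    ← sub_eq_add_neg]
  rw [AddMonoidAlgebra.coeff_sum, Finsupp.finsetSum_apply]
  push_cast
  refine Finset.sum_congr rfl fun l _ => ?_
  rw [AddMonoidAlgebra.coeff_single, Finsupp.single_apply]

theorem coeff_schur_char (m n : ℕ) (μ : ℤ × ℤ) :
    (schur charX charY (m + 1) (n + 1)).coeff μ =
      (Module.finrank ℂ (weightSpace (simpleModule m n) μ) : ℤ) := by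
  rw [finrank_weightSpace_eq_ncard, schur, ← completeChar_zVar, ← completeChar_zInv,
    AddMonoidAlgebra.coeff_sub, Finsupp.sub_apply, coeff_completeChar_mul]
  congr 1
  cases m with
  | zero => simp [completeSeq, exponents_neg_left]
  | succ m =>
    cases n with
    | zero => simp [completeSeq, exponents_neg_right]
    | succ n =>
      rw [← completeChar_zVar, ← completeChar_zInv, coeff_completeChar_mul]
      push_cast
      rw [add_sub_cancel_right, add_sub_cancel_right]

theorem simpleClass_eq_schur (m n : ℕ) :
    simpleClass m n = schur charX charY (m + 1) (n + 1) := by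
  rw [simpleClass, character]
  simp only [← coeff_schur_char]
  set F := schur charX charY (m + 1) (n + 1)
  rw [finsum_eq_sum_of_support_subset (s := F.coeff.support)]
  · exact F.sum_coeff_single
  · intro μ hμ
    rw [Finset.mem_coe, Finsupp.mem_support_iff]
    intro h
    exact hμ (by simp [h])

theorem simpleClass_one_zero : simpleClass 1 0 = charX := by
  rw [simpleClass_eq_schur, schur_two_one]

theorem simpleClass_zero_one : simpleClass 0 1 = charY := by
  rw [simpleClass_eq_schur, schur_one_two]

end Character

/-! ### Independence of the fundamental characters and the integers `d^{k,l}_{m,n}` -/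

section Coefficients
open AddMonoidAlgebra

/-- The polynomial ring `ℤ[X, Y]`, with the coefficient function on `ℕ × ℕ` that `dCoeff` uses. -/
abbrev PairRing : Type := AddMonoidAlgebra ℤ (ℕ × ℕ)

/-- The variable `X`. -/
noncomputable def pairX : PairRing := single (1, 0) 1

/-- The variable `Y`. -/
noncomputable def pairY : PairRing := single (0, 1) 1

theorem pairX_mul_single (k l : ℕ) (a : ℤ) :
    pairX * single (k, l) a = single (k + 1, l) a := by
  rw [pairX, single_mul_single, one_mul, Prod.mk_add_mk, zero_add, add_comm]

theorem pairY_mul_single (k l : ℕ) (a : ℤ) :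
    pairY * single (k, l) a = single (k, l + 1) a := by
  rw [pairY, single_mul_single, one_mul, Prod.mk_add_mk, zero_add, add_comm 1]

/-- Evaluation at the two fundamental characters. -/
noncomputable def evalChar : PairRing →ₐ[ℤ] WeightRing :=
  lift ℤ WeightRing (ℕ × ℕ)
    { toFun := fun kl => charX ^ kl.toAdd.1 * charY ^ kl.toAdd.2
      map_one' := by simp
      map_mul' := fun a b => by simp [pow_add]; ring }

theorem evalChar_apply (p : PairRing) :
    evalChar p = p.coeff.sum fun kl a => a • (charX ^ kl.1 * charY ^ kl.2) := by
  rw [evalChar, lift_apply]; rfl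

theorem evalChar_pairX : evalChar pairX = charX := by
  rw [evalChar_apply, pairX, coeff_single, Finsupp.sum_single_index] <;> simp

theorem evalChar_pairY : evalChar pairY = charY := by
  rw [evalChar_apply, pairY, coeff_single, Finsupp.sum_single_index] <;> simp

/-- The elements of the group ring supported on weights `(a, b)` with `a + b < n`. -/
def heightLT (n : ℤ) : AddSubgroup WeightRing where
  carrier := {f | ∀ μ : ℤ × ℤ, n ≤ μ.1 + μ.2 → f.coeff μ = 0}
  zero_mem' := by intro μ _; rfl
  add_mem' := by
    intro f g hf hg μ hμ
    rw [coeff_add, Finsupp.add_apply, hf μ hμ, hg μ hμ, add_zero]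
  neg_mem' := by
    intro f hf μ hμ
    rw [coeff_neg, Finsupp.neg_apply, hf μ hμ, neg_zero]

theorem heightLT_mono {m n : ℤ} (h : m ≤ n) : heightLT m ≤ heightLT n :=
  fun _ hf μ hμ => hf μ (h.trans hμ)

theorem single_mul_mem_heightLT {n : ℤ} (ν : ℤ × ℤ) {f : WeightRing} (hf : f ∈ heightLT n) :
    single ν 1 * f ∈ heightLT (n + (ν.1 + ν.2)) := by
  intro μ hμ
  rw [coeff_single_mul_apply, one_mul]
  apply hf
  simp only [Prod.fst_add, Prod.snd_add, Prod.fst_neg, Prod.snd_neg]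
  omega

theorem single_mem_heightLT {n : ℤ} (ν : ℤ × ℤ) (h : ν.1 + ν.2 < n) :
    (single ν 1 : WeightRing) ∈ heightLT n := by
  intro μ hμ
  rw [coeff_single, Finsupp.single_apply, if_neg]
  rintro rfl
  omega

theorem charX_eq : charX = single (1, 0) 1 + single (-1, 1) 1 + single (0, -1) 1 := by
  simp [charX, zVar, epsWeight, Fin.sum_univ_three]

theorem charY_eq : charY = single (-1, 0) 1 + single (1, -1) 1 + single (0, 1) 1 := by
  simp [charY, zInv, epsWeight, Fin.sum_univ_three]

theorem charX_mul_leading {k l : ℤ} {f : WeightRing}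
    (h : f - single (k, l) 1 ∈ heightLT (k + l)) :
    charX * f - single (k + 1, l) 1 ∈ heightLT (k + l + 1) := by
  have hs : (single (k + 1, l) 1 : WeightRing) = single (1, 0) 1 * single (k, l) 1 := by
    rw [single_mul_single, Prod.mk_add_mk, mul_one]; congr 2 <;> ring
  have hf : charX * f - single (k + 1, l) 1 = single (1, 0) 1 * (f - single (k, l) 1) +
      single (-1, 1) 1 * (f - single (k, l) 1) + single (0, -1) 1 * (f - single (k, l) 1) +
      (single ((-1, 1) + (k, l)) 1 + single ((0, -1) + (k, l)) 1) := by
    have ha := single_mul_single (R := ℤ) (-1, 1) (k, l) 1 1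
    have hb := single_mul_single (R := ℤ) (0, -1) (k, l) 1 1
    rw [mul_one] at ha hb
    rw [hs, ← ha, ← hb, charX_eq]
    ring
  rw [hf]
  refine add_mem (add_mem (add_mem (heightLT_mono ?_ (single_mul_mem_heightLT _ h))
    (heightLT_mono ?_ (single_mul_mem_heightLT _ h)))
    (heightLT_mono ?_ (single_mul_mem_heightLT _ h)))
    (add_mem (single_mem_heightLT _ ?_) (single_mem_heightLT _ ?_))
  all_goals simp only [Prod.mk_add_mk]; omega

theorem charY_mul_leading {k l : ℤ} {f : WeightRing}
    (h : f - single (k, l) 1 ∈ heightLT (k + l)) :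
    charY * f - single (k, l + 1) 1 ∈ heightLT (k + l + 1) := by
  have hs : (single (k, l + 1) 1 : WeightRing) = single (0, 1) 1 * single (k, l) 1 := by
    rw [single_mul_single, Prod.mk_add_mk, mul_one]; congr 2 <;> ring
  have hf : charY * f - single (k, l + 1) 1 = single (0, 1) 1 * (f - single (k, l) 1) +
      single (-1, 0) 1 * (f - single (k, l) 1) + single (1, -1) 1 * (f - single (k, l) 1) +
      (single ((-1, 0) + (k, l)) 1 + single ((1, -1) + (k, l)) 1) := by
    have ha := single_mul_single (R := ℤ) (-1, 0) (k, l) 1 1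
    have hb := single_mul_single (R := ℤ) (1, -1) (k, l) 1 1
    rw [mul_one] at ha hb
    rw [hs, ← ha, ← hb, charY_eq]
    ring
  rw [hf]
  refine add_mem (add_mem (add_mem (heightLT_mono ?_ (single_mul_mem_heightLT _ h))
    (heightLT_mono ?_ (single_mul_mem_heightLT _ h)))
    (heightLT_mono ?_ (single_mul_mem_heightLT _ h)))
    (add_mem (single_mem_heightLT _ ?_) (single_mem_heightLT _ ?_))
  all_goals simp only [Prod.mk_add_mk]; omega

/-- The monomial `X^k Y^l` in the fundamental characters has the highest term `e^{(k,l)}`. -/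
theorem monomial_leading (k l : ℕ) :
    charX ^ k * charY ^ l - single ((k : ℤ), (l : ℤ)) 1 ∈ heightLT (k + l) := by
  induction k with
  | zero =>
    induction l with
    | zero => simp [one_def, Prod.mk_zero_zero, zero_mem]
    | succ l ih =>
      rw [pow_succ', mul_left_comm, Nat.cast_succ, ← add_assoc]
      exact charY_mul_leading ih
  | succ k ih =>
    rw [pow_succ', mul_assoc, Nat.cast_succ, add_right_comm]
    exact charX_mul_leading ih

theorem evalChar_injective : Function.Injective evalChar := by
  rw [injective_iff_map_eq_zero]
  intro p hp
  by_contra hne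
  have hsupp : p.coeff.support.Nonempty := by
    rw [Finsupp.support_nonempty_iff]; simpa using hne
  obtain ⟨⟨k, l⟩, hkl, hmax⟩ := Finset.exists_max_image p.coeff.support
    (fun kl : ℕ × ℕ => kl.1 + kl.2) hsupp
  have h := congrArg (fun f : WeightRing => f.coeff ((k : ℤ), (l : ℤ))) hp
  simp only [evalChar_apply, Finsupp.sum, coeff_sum, Finsupp.finsetSum_apply, coeff_smul,
    Finsupp.smul_apply] at h
  rw [Finset.sum_eq_single (k, l)] at h
  · have h1 := monomial_leading k l (k, l) le_rfl
    rw [coeff_sub, Finsupp.sub_apply, coeff_single, Finsupp.single_eq_same, sub_eq_zero] at h1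
    rw [h1] at h
    simp at h hkl
    exact hkl h
  · rintro ⟨k', l'⟩ hkl' hne'
    have hle := hmax _ hkl'
    simp only at hle
    have h1 := monomial_leading k' l' (k, l) (by simp only; omega)
    rw [coeff_sub, Finsupp.sub_apply, coeff_single, Finsupp.single_apply, if_neg, sub_zero] at h1
    · simp only [h1, smul_zero]
    · intro h2
      apply hne'
      simpa using h2
  · intro h; exact absurd hkl h

theorem dCoeff_eq_schur (m n : ℕ) : dCoeff m n = (schur pairX pairY (m + 1) (n + 1)).coeff := by
  have key : ∀ p : PairRing, simpleClass m n = (p.coeff.sum fun kl a =>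
      a • (simpleClass 1 0 ^ kl.1 * simpleClass 0 1 ^ kl.2)) ↔
        p = schur pairX pairY (m + 1) (n + 1) := by
    intro p
    rw [simpleClass_one_zero, simpleClass_zero_one, ← evalChar_apply, simpleClass_eq_schur,
      ← evalChar_injective.eq_iff, ← evalChar_pairX, ← evalChar_pairY, eq_comm]
    exact Eq.congr_right (map_schur _ _ (evalChar : PairRing →+* WeightRing) _ _).symm
  have hex : simpleClass m n = (dCoeff m n).sum fun kl a =>
      a • (simpleClass 1 0 ^ kl.1 * simpleClass 0 1 ^ kl.2) :=
    Classical.epsilon_spec (p := fun d : ℕ × ℕ →₀ ℤ => simpleClass m n = d.sum fun kl a =>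
      a • (simpleClass 1 0 ^ kl.1 * simpleClass 0 1 ^ kl.2)) ⟨_, (key _).2 rfl⟩
  exact congrArg AddMonoidAlgebra.coeff ((key (ofCoeff (dCoeff m n))).1 hex)

end Coefficients

/-! ### Multiplication in `T_∞` -/

section Generic
open AddMonoidAlgebra

theorem vNumber_two_ne_zero : vNumber 2 ≠ 0 := by
  have hX : (RatFunc.X : Cv) ≠ 0 := RatFunc.X_ne_zero
  have hpow : ∀ n : ℕ, 0 < n → (RatFunc.X : Cv) ^ n ≠ 1 := by
    intro n hn h
    rw [← RatFunc.algebraMap_X, ← map_pow, ← map_one (algebraMap (Polynomial ℂ) Cv)] at h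
    have h1 := congrArg Polynomial.natDegree (RatFunc.algebraMap_injective ℂ h)
    rw [Polynomial.natDegree_X_pow, Polynomial.natDegree_one] at h1
    omega
  rw [vNumber]
  refine div_ne_zero ?_ ?_
  · intro h
    rw [sub_eq_zero] at h
    -- `v² = v⁻²` would give `v⁴ = 1`.
    apply hpow 4 (by norm_num)
    have h4 : (RatFunc.X : Cv) ^ 4 = RatFunc.X ^ (2 : ℤ) * RatFunc.X ^ (2 : ℤ) := by
      rw [← zpow_add₀ hX]; rfl
    rw [h4]
    nth_rw 1 [h]
    rw [← zpow_add₀ hX]; simp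
  · intro h
    rw [sub_eq_zero] at h
    apply hpow 2 (by norm_num)
    rw [pow_two]
    nth_rw 1 [h]
    exact inv_mul_cancel₀ hX

theorem theta_mul_self (u : Color) : theta u * theta u = vFactorial 3 • theta u := by
  rw [theta, ← map_mul, RingQuot.mkAlgHom_rel Cv (Rel.quadratic u), map_smul]

theorem theta_cubic (u : Color) :
    theta u * theta (u + 1) * theta u = theta u * theta (u - 1) * theta u := by
  simp only [theta, ← map_mul]
  exact RingQuot.mkAlgHom_rel Cv (Rel.cubic u)

theorem hElt_succ_right (u : Color) (k l : ℕ) :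
    hElt u k (l + 1) = theta (u + k - l - 1) * hElt u k l := by
  rw [hElt]; push_cast; rw [sub_sub]

theorem hElt_succ_zero (u : Color) (k : ℕ) :
    hElt u (k + 1) 0 = theta (u + k + 1) * hElt u k 0 := by
  rw [hElt]; push_cast; rw [add_assoc]

theorem exists_hElt_eq_theta_mul (u : Color) (k l : ℕ) :
    ∃ x, hElt u k l = theta (u + k - l) * x := by
  cases l with
  | succ l => exact ⟨_, by rw [hElt_succ_right, Nat.cast_succ, sub_sub]⟩
  | zero =>
    cases k with
    | zero => exact ⟨1, by simp [hElt]⟩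
    | succ k => exact ⟨_, by rw [hElt_succ_zero, Nat.cast_succ, Nat.cast_zero, sub_zero, add_assoc]⟩

theorem theta_mul_hElt_self (u : Color) (k l : ℕ) :
    theta (u + k - l) * hElt u k l = vFactorial 3 • hElt u k l := by
  obtain ⟨x, hx⟩ := exists_hElt_eq_theta_mul u k l
  rw [hx, ← mul_assoc, theta_mul_self, smul_mul_assoc]

/-- By the cubic relations, a rotation by `ρ` may be moved past the rotations by `ρ⁻¹`. -/
theorem hElt_succ_left (u : Color) (k l : ℕ) :
    hElt u (k + 1) l = theta (u + k - l + 1) * hElt u k l := by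
  induction l with
  | zero => rw [hElt_succ_zero, Nat.cast_zero, sub_zero]
  | succ l ih =>
    obtain ⟨x, hx⟩ := exists_hElt_eq_theta_mul u k l
    have h1 : u + ((k + 1 : ℕ) : Color) - l - 1 = u + k - l := by push_cast; ring
    have h2 : u + (k : Color) - ((l + 1 : ℕ) : Color) + 1 = u + k - l := by push_cast; ring
    rw [hElt_succ_right, ih, hElt_succ_right, h1, h2, hx]
    have h := congrArg (· * x) (theta_cubic (u + k - l))
    simpa only [mul_assoc] using h

/-- The additive extension of `X^k Y^l ↦ [2]^{-k-l} h^u_{k,l}` to polynomials. -/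
noncomputable def hMap (u : Color) : PairRing →+ TInfty :=
  AddMonoidHom.mk' (fun p => p.coeff.sum fun kl a =>
    (vNumber 2 ^ (-(kl.1 : ℤ) - (kl.2 : ℤ)) * (a : Cv)) • hElt u kl.1 kl.2) fun p p' => by
      rw [coeff_add, Finsupp.sum_add_index']
      · simp
      · intro _ _ _; push_cast; rw [mul_add, add_smul]

theorem hMap_single (u : Color) (k l : ℕ) (a : ℤ) : hMap u (single (k, l) a) =
    (vNumber 2 ^ (-(k : ℤ) - (l : ℤ)) * (a : Cv)) • hElt u k l := by
  change (single (k, l) a : PairRing).coeff.sum (fun kl a =>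
    (vNumber 2 ^ (-(kl.1 : ℤ) - (kl.2 : ℤ)) * (a : Cv)) • hElt u kl.1 kl.2) = _
  rw [coeff_single, Finsupp.sum_single_index]
  simp

/-- The element `C^u_{a-1,b-1}`, with the same shift of indices as in `schur`. -/
noncomputable def schurElt (u : Color) (a b : ℕ) : TInfty := hMap u (schur pairX pairY a b)

theorem rightKL_eq_schurElt (u : Color) (m n : ℕ) : rightKL u m n = schurElt u (m + 1) (n + 1) := by
  rw [rightKL, dCoeff_eq_schur]; rfl

theorem schurElt_zero_left (u : Color) (b : ℕ) : schurElt u 0 b = 0 := by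
  rw [schurElt, schur_zero_left, map_zero]

theorem schurElt_zero_right (u : Color) (a : ℕ) : schurElt u a 0 = 0 := by
  rw [schurElt, schur_zero_right, map_zero]

theorem schurElt_one_one (u : Color) : schurElt u 1 1 = theta u := by
  rw [schurElt, schur_one_one, AddMonoidAlgebra.one_def, ← Prod.mk_zero_zero, hMap_single]
  simp [hElt]

/-- The polynomials spanned by the `X^k Y^l` with `k - l` congruent to `r` modulo `3`. For these, all
monomials `h^u_{k,l}` that occur end in the same colour `u + r`. -/
noncomputable def colorPart (r : Color) : AddSubgroup PairRing :=
  AddSubgroup.closure {p | ∃ (k l : ℕ) (a : ℤ), (k : Color) - l = r ∧ p = single (k, l) a}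

theorem pairX_mul_mem_colorPart {r : Color} {p : PairRing} (hp : p ∈ colorPart r) :
    pairX * p ∈ colorPart (r + 1) := by
  induction hp using AddSubgroup.closure_induction with
  | zero => rw [mul_zero]; exact zero_mem _
  | add p p' _ _ h h' => rw [mul_add]; exact add_mem h h'
  | neg p _ h => rw [mul_neg]; exact neg_mem h
  | mem x hx =>
    obtain ⟨k, l, a, h, rfl⟩ := hx
    rw [pairX_mul_single]
    exact AddSubgroup.subset_closure ⟨k + 1, l, a, by rw [← h]; push_cast; ring, rfl⟩

theorem pairY_mul_mem_colorPart {r : Color} {p : PairRing} (hp : p ∈ colorPart r) :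
    pairY * p ∈ colorPart (r - 1) := by
  induction hp using AddSubgroup.closure_induction with
  | zero => rw [mul_zero]; exact zero_mem _
  | add p p' _ _ h h' => rw [mul_add]; exact add_mem h h'
  | neg p _ h => rw [mul_neg]; exact neg_mem h
  | mem x hx =>
    obtain ⟨k, l, a, h, rfl⟩ := hx
    rw [pairY_mul_single]
    exact AddSubgroup.subset_closure ⟨k, l + 1, a, by rw [← h]; push_cast; ring, rfl⟩

theorem schur_mem_colorPart (a b : ℕ) : schur pairX pairY a b ∈ colorPart ((a : Color) - b) := by
  have h3 : (3 : Color) = 0 := rfl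
  induction a, b using schur_induction with
  | zero_left b => rw [schur_zero_left]; exact zero_mem _
  | zero_right a => rw [schur_zero_right]; exact zero_mem _
  | one_one =>
    rw [schur_one_one, one_def]
    exact AddSubgroup.subset_closure ⟨0, 0, 1, by simp, rfl⟩
  | left a b h1 h2 h3' =>
    rw [show schur pairX pairY (a + 2) (b + 1) = pairX * schur pairX pairY (a + 1) (b + 1) -
      schur pairX pairY a (b + 2) - schur pairX pairY (a + 1) b by rw [mul_schur_left]; abel]
    have e1 : ((a + 2 : ℕ) : Color) - (b + 1 : ℕ) = ((a + 1 : ℕ) : Color) - (b + 1 : ℕ) + 1 := by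
      push_cast; ring
    have e2 : ((a + 2 : ℕ) : Color) - (b + 1 : ℕ) = (a : Color) - (b + 2 : ℕ) := by
      push_cast; linear_combination h3
    have e3 : ((a + 2 : ℕ) : Color) - (b + 1 : ℕ) = ((a + 1 : ℕ) : Color) - b := by
      push_cast; ring
    refine sub_mem (sub_mem ?_ (e2 ▸ h2)) (e3 ▸ h3')
    rw [e1]; exact pairX_mul_mem_colorPart h1
  | right a b h1 h2 h3' =>
    rw [show schur pairX pairY (a + 1) (b + 2) = pairY * schur pairX pairY (a + 1) (b + 1) -
      schur pairX pairY (a + 2) b - schur pairX pairY a (b + 1) by rw [mul_schur_right]; abel]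
    have e1 : ((a + 1 : ℕ) : Color) - (b + 2 : ℕ) = ((a + 1 : ℕ) : Color) - (b + 1 : ℕ) - 1 := by
      push_cast; ring
    have e2 : ((a + 1 : ℕ) : Color) - (b + 2 : ℕ) = ((a + 2 : ℕ) : Color) - b := by
      push_cast; linear_combination -h3
    have e3 : ((a + 1 : ℕ) : Color) - (b + 2 : ℕ) = (a : Color) - (b + 1 : ℕ) := by
      push_cast; ring
    refine sub_mem (sub_mem ?_ (e2 ▸ h2)) (e3 ▸ h3')
    rw [e1]; exact pairY_mul_mem_colorPart h1

theorem theta_mul_hMap (u : Color) {r : Color} {p : PairRing} (hp : p ∈ colorPart r) :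
    theta (u + r) * hMap u p = vFactorial 3 • hMap u p ∧
    theta (u + r + 1) * hMap u p = vNumber 2 • hMap u (pairX * p) ∧
    theta (u + r - 1) * hMap u p = vNumber 2 • hMap u (pairY * p) := by
  have hz : ∀ n : ℤ, vNumber 2 ^ n = vNumber 2 * vNumber 2 ^ (n - 1) := fun n => by
    rw [← zpow_one_add₀ vNumber_two_ne_zero, add_sub_cancel]
  -- Both sides of each identity are additive in `p`, so single monomials suffice.
  have key : ∀ (w : Color) (c : Cv) (s : PairRing),
      (∀ (k l : ℕ) (a : ℤ), (k : Color) - l = r →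
        theta w * hMap u (single (k, l) a) = c • hMap u (s * single (k, l) a)) →
      theta w * hMap u p = c • hMap u (s * p) := by
    intro w c s h
    have h1 : Set.EqOn ((AddMonoidHom.mulLeft (theta w)).comp (hMap u))
        ((DistribSMul.toAddMonoidHom TInfty c).comp ((hMap u).comp (AddMonoidHom.mulLeft s)))
        (colorPart r) := by
      apply AddMonoidHom.eqOn_closure
      rintro _ ⟨k, l, a, hkl, rfl⟩
      exact h k l a hkl
    exact h1 hp
  refine ⟨?_, key _ _ _ ?_, key _ _ _ ?_⟩
  · have h := key (u + r) (vFactorial 3) 1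
    rw [one_mul] at h
    refine h fun k l a hkl => ?_
    rw [one_mul, hMap_single, ← hkl, add_sub, mul_smul_comm, theta_mul_hElt_self, smul_comm]
  · intro k l a hkl
    rw [pairX_mul_single, hMap_single, hMap_single, ← hkl, add_sub, mul_smul_comm,
      ← hElt_succ_left, hz, smul_smul, mul_assoc]
    push_cast; ring_nf
  · intro k l a hkl
    rw [pairY_mul_single, hMap_single, hMap_single, ← hkl, add_sub, mul_smul_comm,
      ← hElt_succ_right, hz, smul_smul, mul_assoc]
    push_cast; ring_nf

theorem theta_mul_schurElt_self (u : Color) (a b : ℕ) :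
    theta (u + (a - b)) * schurElt u a b = vFactorial 3 • schurElt u a b :=
  (theta_mul_hMap u (schur_mem_colorPart a b)).1

theorem theta_mul_schurElt_left (u : Color) (a b : ℕ) :
    theta (u + (a - b) + 1) * schurElt u (a + 1) (b + 1) = vNumber 2 •
      (schurElt u (a + 2) (b + 1) + schurElt u a (b + 2) + schurElt u (a + 1) b) := by
  have h := (theta_mul_hMap u (schur_mem_colorPart (a + 1) (b + 1))).2.1
  rw [mul_schur_left, map_add, map_add] at h
  push_cast at h
  rw [add_sub_add_right_eq_sub] at h
  exact h

theorem theta_mul_schurElt_right (u : Color) (a b : ℕ) :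
    theta (u + (a - b) - 1) * schurElt u (a + 1) (b + 1) = vNumber 2 •
      (schurElt u (a + 1) (b + 2) + schurElt u (a + 2) b + schurElt u a (b + 1)) := by
  have h := (theta_mul_hMap u (schur_mem_colorPart (a + 1) (b + 1))).2.2
  rw [mul_schur_right, map_add, map_add] at h
  push_cast at h
  rw [add_sub_add_right_eq_sub] at h
  exact h

end Generic

/-! ### Spanning -/

section Spanning

theorem proj_schurElt_mem (e : ℕ) (u : Color) (a b : ℕ) (h : a + b ≤ e + 3) :
    proj e (schurElt u a b) ∈ Submodule.span Cv (Set.range (rightFamily e)) := by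
  rcases a with _ | m
  · rw [schurElt_zero_left, map_zero]; exact zero_mem _
  rcases b with _ | n
  · rw [schurElt_zero_right, map_zero]; exact zero_mem _
  rw [← rightKL_eq_schurElt]
  by_cases hmn : m + n ≤ e
  · exact Submodule.subset_span ⟨some (u, ⟨(m, n), hmn⟩), rfl⟩
  · have h0 : proj e (rightKL u m n) = 0 := by
      rw [proj, Ideal.Quotient.mkₐ_eq_mk, Ideal.Quotient.eq_zero_iff_mem, TwoSidedIdeal.mem_asIdeal]
      exact TwoSidedIdeal.subset_span ⟨u, m, n, by omega, rfl⟩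
    rw [h0]; exact zero_mem _

theorem theta_mul_mem_span (e : ℕ) (w : Color) {x : TLevel e}
    (hx : x ∈ Submodule.span Cv (Set.range (rightFamily e))) :
    proj e (theta w) * x ∈ Submodule.span Cv (Set.range (rightFamily e)) := by
  induction hx using Submodule.span_induction with
  | zero => rw [mul_zero]; exact zero_mem _
  | add x y _ _ hx hy => rw [mul_add]; exact add_mem hx hy
  | smul c x _ hx => rw [mul_smul_comm]; exact Submodule.smul_mem _ _ hx
  | mem x hx =>
    obtain ⟨_ | ⟨u, ⟨⟨m, n⟩, hmn⟩⟩, rfl⟩ := hx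
    · rw [rightFamily, mul_one, ← schurElt_one_one]
      exact proj_schurElt_mem _ _ _ _ (by omega)
    · simp only at hmn
      rw [rightFamily, ← map_mul, rightKL_eq_schurElt]
      -- The colour of `θ_w` is one of the three, relative to the final colour of `C^u_{m,n}`.
      have hw : w = u + (m - n) ∨ w = u + (m - n) + 1 ∨ w = u + (m - n) - 1 := by
        generalize u + ((m : Color) - n) = c
        revert w c; decide
      rcases hw with rfl | rfl | rfl
      · have h := theta_mul_schurElt_self u (m + 1) (n + 1)
        push_cast at h
        rw [add_sub_add_right_eq_sub] at h
        rw [h, map_smul]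
        exact Submodule.smul_mem _ _ (proj_schurElt_mem _ _ _ _ (by omega))
      · rw [theta_mul_schurElt_left, map_smul, map_add, map_add]
        exact Submodule.smul_mem _ _ (add_mem (add_mem (proj_schurElt_mem _ _ _ _ (by omega))
          (proj_schurElt_mem _ _ _ _ (by omega))) (proj_schurElt_mem _ _ _ _ (by omega)))
      · rw [theta_mul_schurElt_right, map_smul, map_add, map_add]
        exact Submodule.smul_mem _ _ (add_mem (add_mem (proj_schurElt_mem _ _ _ _ (by omega))
          (proj_schurElt_mem _ _ _ _ (by omega))) (proj_schurElt_mem _ _ _ _ (by omega)))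

theorem span_rightFamily (e : ℕ) : Submodule.span Cv (Set.range (rightFamily e)) = ⊤ := by
  have key : ∀ (f : FreeAlgebra Cv Color) (x : TLevel e),
      x ∈ Submodule.span Cv (Set.range (rightFamily e)) →
      proj e (RingQuot.mkAlgHom Cv Rel f) * x ∈
        Submodule.span Cv (Set.range (rightFamily e)) := by
    intro f
    induction f using FreeAlgebra.induction with
    | grade0 c =>
      intro x hx
      rw [AlgHom.commutes, AlgHom.commutes, ← Algebra.smul_def]
      exact Submodule.smul_mem _ _ hx
    | grade1 w => exact fun x hx => theta_mul_mem_span e w hx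
    | mul f g hf hg =>
      intro x hx
      rw [map_mul, map_mul, mul_assoc]
      exact hf _ (hg _ hx)
    | add f g hf hg =>
      intro x hx
      rw [map_add, map_add, add_mul]
      exact add_mem (hf _ hx) (hg _ hx)
  refine Submodule.eq_top_iff'.2 fun x => ?_
  obtain ⟨y, rfl⟩ := Ideal.Quotient.mk_surjective x
  obtain ⟨f, rfl⟩ := RingQuot.mkAlgHom_surjective Cv Rel y
  have h := key f 1 (Submodule.subset_span ⟨none, rfl⟩)
  rwa [mul_one] at h

end Spanning

/-! ### Truncated multiplication operators on the alcove -/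

section Alcove

/-- The dominant weights of level at most `e`. -/
abbrev Alcove (e : ℕ) : Type := {mn : ℕ × ℕ // mn.1 + mn.2 ≤ e}

noncomputable instance (e : ℕ) : Fintype (Alcove e) :=
  Fintype.subtype ((Finset.range (e + 1)).biUnion Finset.HasAntidiagonal.antidiagonal) fun p => by
    simp

theorem card_alcove (e : ℕ) : Fintype.card (Alcove e) = (e + 1) * (e + 2) / 2 := by
  rw [Fintype.card_of_subtype ((Finset.range (e + 1)).biUnion Finset.HasAntidiagonal.antidiagonal) fun p => by
    simp, Finset.card_biUnion]
  · simp only [Finset.Nat.card_antidiagonal]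
    have h := Finset.sum_range_succ' (fun i => i) (e + 1)
    rw [add_zero, Finset.sum_range_id, mul_comm] at h
    exact h.symm
  · intro i _ j _ hij
    refine Finset.disjoint_left.2 fun p hp hp' => hij ?_
    rw [Finset.HasAntidiagonal.mem_antidiagonal] at hp hp'
    exact hp.symm.trans hp'

/-- The space with a basis indexed by the weights of level at most `e`. -/
abbrev AlcoveSpace (e : ℕ) : Type := Alcove e → Cv

variable {e : ℕ}

/-- The coefficient of `f` at the weight `(a - 1, b - 1)`, and zero outside the alcove. -/
noncomputable def extend (f : AlcoveSpace e) (a b : ℕ) : Cv :=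
  if h : 1 ≤ a ∧ 1 ≤ b ∧ a + b ≤ e + 2 then f ⟨(a - 1, b - 1), by simp only; omega⟩ else 0

theorem extend_zero_left (f : AlcoveSpace e) (b : ℕ) : extend f 0 b = 0 := by simp [extend]

theorem extend_zero_right (f : AlcoveSpace e) (a : ℕ) : extend f a 0 = 0 := by simp [extend]

theorem extend_of_lt (f : AlcoveSpace e) {a b : ℕ} (h : e + 2 < a + b) : extend f a b = 0 := by
  rw [extend, dif_neg (by omega)]

theorem extend_succ (f : AlcoveSpace e) (m n : ℕ) (h : m + n ≤ e) :
    extend f (m + 1) (n + 1) = f ⟨(m, n), h⟩ := by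
  rw [extend, dif_pos (by omega)]; rfl

theorem extend_add (f g : AlcoveSpace e) (a b : ℕ) :
    extend (f + g) a b = extend f a b + extend g a b := by
  unfold extend; split_ifs <;> simp

theorem extend_smul (c : Cv) (f : AlcoveSpace e) (a b : ℕ) :
    extend (c • f) a b = c * extend f a b := by
  unfold extend; split_ifs <;> simp

/-- Multiplication by `X`, sending the basis vector at a weight to the sum of those at the neighbours
`(1, 0)`, `(-1, 1)`, `(0, -1)` that lie in the alcove. -/
noncomputable def mulX (e : ℕ) : AlcoveSpace e →ₗ[Cv] AlcoveSpace e where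
  toFun f p := extend f p.1.1 (p.1.2 + 1) + extend f (p.1.1 + 2) p.1.2 +
    extend f (p.1.1 + 1) (p.1.2 + 2)
  map_add' f g := by ext p; simp only [extend_add, Pi.add_apply]; ring
  map_smul' c f := by
    ext p; simp only [extend_smul, Pi.smul_apply, smul_eq_mul, RingHom.id_apply]; ring

/-- Multiplication by `Y`, sending the basis vector at a weight to the sum of those at the neighbours
`(0, 1)`, `(1, -1)`, `(-1, 0)` that lie in the alcove. -/
noncomputable def mulY (e : ℕ) : AlcoveSpace e →ₗ[Cv] AlcoveSpace e where
  toFun f p := extend f (p.1.1 + 1) p.1.2 + extend f p.1.1 (p.1.2 + 2) +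
    extend f (p.1.1 + 2) (p.1.2 + 1)
  map_add' f g := by ext p; simp only [extend_add, Pi.add_apply]; ring
  map_smul' c f := by
    ext p; simp only [extend_smul, Pi.smul_apply, smul_eq_mul, RingHom.id_apply]; ring

theorem mulX_apply (f : AlcoveSpace e) (p : Alcove e) :
    mulX e f p = extend f p.1.1 (p.1.2 + 1) + extend f (p.1.1 + 2) p.1.2 +
      extend f (p.1.1 + 1) (p.1.2 + 2) := rfl

theorem mulY_apply (f : AlcoveSpace e) (p : Alcove e) :
    mulY e f p = extend f (p.1.1 + 1) p.1.2 + extend f p.1.1 (p.1.2 + 2) +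
      extend f (p.1.1 + 2) (p.1.2 + 1) := rfl

theorem extend_mulX (f : AlcoveSpace e) (a b : ℕ) : extend (mulX e f) a b =
    if 1 ≤ a ∧ 1 ≤ b ∧ a + b ≤ e + 2 then
      extend f (a - 1) b + extend f (a + 1) (b - 1) + extend f a (b + 1) else 0 := by
  split_ifs with h
  · obtain ⟨m, rfl⟩ := Nat.exists_eq_add_of_le' h.1
    obtain ⟨n, rfl⟩ := Nat.exists_eq_add_of_le' h.2.1
    rw [extend_succ _ _ _ (by omega), mulX_apply]; rfl
  · rw [extend, dif_neg h]

theorem extend_mulY (f : AlcoveSpace e) (a b : ℕ) : extend (mulY e f) a b =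
    if 1 ≤ a ∧ 1 ≤ b ∧ a + b ≤ e + 2 then
      extend f a (b - 1) + extend f (a - 1) (b + 1) + extend f (a + 1) b else 0 := by
  split_ifs with h
  · obtain ⟨m, rfl⟩ := Nat.exists_eq_add_of_le' h.1
    obtain ⟨n, rfl⟩ := Nat.exists_eq_add_of_le' h.2.1
    rw [extend_succ _ _ _ (by omega), mulY_apply]; rfl
  · rw [extend, dif_neg h]

theorem mulX_mulY_comm (e : ℕ) : Commute (mulX e) (mulY e) := by
  refine LinearMap.ext fun f => funext fun ⟨⟨m, n⟩, h⟩ => ?_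
  simp only at h
  rw [Module.End.mul_apply, Module.End.mul_apply, mulX_apply, mulY_apply]
  simp only [extend_mulX, extend_mulY]
  rcases eq_or_lt_of_le h with h' | h'
  · -- Next to the upper wall, the terms beyond that wall vanish.
    have z0 : extend f m (n + 3) = 0 := extend_of_lt _ (by omega)
    have z3 : extend f (m + 3) n = 0 := extend_of_lt _ (by omega)
    rcases m with _ | m <;> rcases n with _ | n <;>
      simp only [Nat.add_assoc, Nat.reduceAdd, zero_add] at z0 z3 <;>
      simp [extend_zero_left, extend_zero_right, Nat.add_assoc] <;>
      split_ifs <;> first | omega | (simp only [z0, z3]; ring)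
  · rcases m with _ | m <;> rcases n with _ | n <;>
      simp [extend_zero_left, extend_zero_right, Nat.add_assoc] <;>
      split_ifs <;> first | omega | ring

/-- The basis vector at the weight `(a - 1, b - 1)`, which is zero outside the alcove. -/
noncomputable def delta (e a b : ℕ) : AlcoveSpace e :=
  fun p => if p.1.1 + 1 = a ∧ p.1.2 + 1 = b then 1 else 0

theorem extend_delta (a b i j : ℕ) (h : a + b ≤ e) : extend (delta e (a + 1) (b + 1)) i j =
    if i = a + 1 ∧ j = b + 1 then 1 else 0 := by
  by_cases hij : 1 ≤ i ∧ 1 ≤ j ∧ i + j ≤ e + 2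
  · rw [extend, dif_pos hij]
    exact if_congr (by simp only; omega) rfl rfl
  · rw [extend, dif_neg hij, if_neg (by omega)]

theorem mulX_delta (a b : ℕ) (h : a + b ≤ e) : mulX e (delta e (a + 1) (b + 1)) =
    delta e (a + 2) (b + 1) + delta e a (b + 2) + delta e (a + 1) b := by
  ext ⟨⟨m, n⟩, hmn⟩
  rw [mulX_apply, extend_delta _ _ _ _ h, extend_delta _ _ _ _ h, extend_delta _ _ _ _ h]
  simp only [delta, Pi.add_apply]
  congr 1
  · congr 1 <;> exact if_congr (by omega) rfl rfl
  · exact if_congr (by omega) rfl rfl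

theorem mulY_delta (a b : ℕ) (h : a + b ≤ e) : mulY e (delta e (a + 1) (b + 1)) =
    delta e (a + 1) (b + 2) + delta e (a + 2) b + delta e a (b + 1) := by
  ext ⟨⟨m, n⟩, hmn⟩
  rw [mulY_apply, extend_delta _ _ _ _ h, extend_delta _ _ _ _ h, extend_delta _ _ _ _ h]
  simp only [delta, Pi.add_apply]
  congr 1
  · congr 1 <;> exact if_congr (by omega) rfl rfl
  · exact if_congr (by omega) rfl rfl

/-- Evaluation of polynomials at the commuting operators `mulX` and `mulY`. -/
noncomputable def evalOp (e : ℕ) : PairRing →ₐ[ℤ] Module.End Cv (AlcoveSpace e) :=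
  AddMonoidAlgebra.lift ℤ _ (ℕ × ℕ)
    { toFun := fun kl => mulX e ^ kl.toAdd.1 * mulY e ^ kl.toAdd.2
      map_one' := by simp
      map_mul' := fun a b => by
        have h := ((mulX_mulY_comm e).pow_pow b.toAdd.1 a.toAdd.2).eq
        simp only [toAdd_mul, Prod.fst_add, Prod.snd_add, pow_add, mul_assoc]
        rw [← mul_assoc (mulY e ^ _) (mulX e ^ _), ← h, mul_assoc] }

theorem evalOp_single (k l : ℕ) (a : ℤ) :
    evalOp e (AddMonoidAlgebra.single (k, l) a) = a • (mulX e ^ k * mulY e ^ l) := by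
  rw [evalOp, AddMonoidAlgebra.lift_single]; rfl

theorem evalOp_pairX : evalOp e pairX = mulX e := by
  rw [pairX, evalOp_single]; simp

theorem evalOp_pairY : evalOp e pairY = mulY e := by
  rw [pairY, evalOp_single]; simp

theorem evalOp_schur_delta (a b : ℕ) (h : a + b ≤ e + 3) :
    evalOp e (schur pairX pairY a b) (delta e 1 1) = delta e a b := by
  have hzl : ∀ b, delta e 0 b = 0 := fun b => funext fun p => if_neg (by omega)
  have hzr : ∀ a, delta e a 0 = 0 := fun b => funext fun p => if_neg (by omega)
  revert h
  induction a, b using schur_induction with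
  | zero_left b => intro _; rw [schur_zero_left, map_zero, LinearMap.zero_apply, hzl]
  | zero_right a => intro _; rw [schur_zero_right, map_zero, LinearMap.zero_apply, hzr]
  | one_one => intro _; rw [schur_one_one, map_one, Module.End.one_apply]
  | left a b h1 h2 h3 =>
    intro h
    rw [show schur pairX pairY (a + 2) (b + 1) = pairX * schur pairX pairY (a + 1) (b + 1) -
      schur pairX pairY a (b + 2) - schur pairX pairY (a + 1) b by rw [mul_schur_left]; abel,
      map_sub, map_sub, map_mul, LinearMap.sub_apply, LinearMap.sub_apply, Module.End.mul_apply,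
      h1 (by omega), h2 (by omega), h3 (by omega), evalOp_pairX, mulX_delta _ _ (by omega)]
    abel
  | right a b h1 h2 h3 =>
    intro h
    rw [show schur pairX pairY (a + 1) (b + 2) = pairY * schur pairX pairY (a + 1) (b + 1) -
      schur pairX pairY (a + 2) b - schur pairX pairY a (b + 1) by rw [mul_schur_right]; abel,
      map_sub, map_sub, map_mul, LinearMap.sub_apply, LinearMap.sub_apply, Module.End.mul_apply,
      h1 (by omega), h2 (by omega), h3 (by omega), evalOp_pairY, mulY_delta _ _ (by omega)]
    abel

/-- The operator kills the basis vector at the origin, hence all of the space, as that vector generates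
the space over the commuting operators `mulX` and `mulY`. -/
theorem evalOp_schur_eq_zero (a b : ℕ) (h : a + b = e + 3) :
    evalOp e (schur pairX pairY a b) = 0 := by
  classical
  refine (Pi.basisFun Cv (Alcove e)).ext fun p => ?_
  have hp := p.2
  have h1 : Pi.basisFun Cv (Alcove e) p = delta e (p.1.1 + 1) (p.1.2 + 1) := by
    ext q
    rw [Pi.basisFun_apply, delta, Pi.single_apply]
    refine if_congr ?_ rfl rfl
    rw [Subtype.ext_iff, Prod.ext_iff]; omega
  have h2 : delta e a b = 0 := funext fun q => if_neg (by have := q.2; omega)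
  rw [h1, ← evalOp_schur_delta _ _ (by omega), ← Module.End.mul_apply, ← map_mul, mul_comm,
    map_mul, Module.End.mul_apply, evalOp_schur_delta _ _ h.le, h2, map_zero, LinearMap.zero_apply]

end Alcove

/-! ### The representation of `T_e` and linear independence -/

section Representation

variable (e : ℕ)

/-- The space of the representation of `T_e`. The second factor is a column of a `3 × 3` matrix; the
first factor plays the role of the unit, which `θ_w` maps to the row `w` of that column. -/
abbrev RepSpace : Type := (Color → AlcoveSpace e) × (Color → AlcoveSpace e)

/-- The inclusion of row `w` into the second factor. -/
noncomputable def repIn (w : Color) : AlcoveSpace e →ₗ[Cv] RepSpace e :=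
  LinearMap.inr Cv _ _ ∘ₗ LinearMap.single Cv (fun _ : Color => AlcoveSpace e) w

/-- The row `w` of the product with `θ_w`: it combines the entry `w` of the first factor with
`[3]!` times the entry `w`, `[2] X` times the entry `w - 1` and `[2] Y` times the entry `w + 1` of the
second. -/
noncomputable def repOut (w : Color) : RepSpace e →ₗ[Cv] AlcoveSpace e :=
  LinearMap.proj w ∘ₗ LinearMap.fst Cv _ _ +
    (vFactorial 3 • LinearMap.proj w +
      vNumber 2 • (mulX e ∘ₗ LinearMap.proj (w - 1) + mulY e ∘ₗ LinearMap.proj (w + 1))) ∘ₗ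
        LinearMap.snd Cv (Color → AlcoveSpace e) (Color → AlcoveSpace e)

theorem repOut_apply (w : Color) (x : RepSpace e) : repOut e w x = x.1 w +
    (vFactorial 3 • x.2 w + vNumber 2 • (mulX e (x.2 (w - 1)) + mulY e (x.2 (w + 1)))) := rfl

theorem repIn_fst (w : Color) (f : AlcoveSpace e) : (repIn e w f).1 = 0 := rfl

theorem repIn_snd (w : Color) (f : AlcoveSpace e) : (repIn e w f).2 = Pi.single w f := rfl

theorem repOut_repIn_self (w : Color) : repOut e w ∘ₗ repIn e w = vFactorial 3 • LinearMap.id := by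
  refine LinearMap.ext fun f => ?_
  have h1 : w - 1 ≠ w := by revert w; decide
  have h2 : w + 1 ≠ w := by revert w; decide
  rw [LinearMap.comp_apply, repOut_apply, repIn_fst, repIn_snd, Pi.single_eq_same,
    Pi.single_eq_of_ne h1, Pi.single_eq_of_ne h2]
  simp

theorem repOut_repIn_add (w : Color) : repOut e (w + 1) ∘ₗ repIn e w = vNumber 2 • mulX e := by
  refine LinearMap.ext fun f => ?_
  have h1 : w + 1 ≠ w := by revert w; decide
  have h2 : w + 1 + 1 ≠ w := by revert w; decide
  rw [LinearMap.comp_apply, repOut_apply, repIn_fst, repIn_snd, add_sub_cancel_right,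
    Pi.single_eq_same, Pi.single_eq_of_ne h1, Pi.single_eq_of_ne h2]
  simp

theorem repOut_repIn_sub (w : Color) : repOut e (w - 1) ∘ₗ repIn e w = vNumber 2 • mulY e := by
  refine LinearMap.ext fun f => ?_
  have h1 : w - 1 ≠ w := by revert w; decide
  have h2 : w - 1 - 1 ≠ w := by revert w; decide
  rw [LinearMap.comp_apply, repOut_apply, repIn_fst, repIn_snd, sub_add_cancel,
    Pi.single_eq_same, Pi.single_eq_of_ne h1, Pi.single_eq_of_ne h2]
  simp

/-- The action of `θ_w`. -/
noncomputable def repTheta (w : Color) : Module.End Cv (RepSpace e) := repIn e w ∘ₗ repOut e w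

theorem repTheta_rel ⦃a b : FreeAlgebra Cv Color⦄ (h : Rel a b) :
    FreeAlgebra.lift Cv (repTheta e) a = FreeAlgebra.lift Cv (repTheta e) b := by
  cases h with
  | quadratic u =>
    rw [map_mul, map_smul, FreeAlgebra.lift_ι_apply]
    refine LinearMap.ext fun x => ?_
    have h := LinearMap.congr_fun (repOut_repIn_self e u) (repOut e u x)
    simp only [LinearMap.comp_apply] at h
    simp [repTheta, h]
  | cubic u =>
    simp only [map_mul, FreeAlgebra.lift_ι_apply]
    refine LinearMap.ext fun x => ?_
    have h1 := LinearMap.congr_fun (repOut_repIn_add e u) (repOut e u x)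
    have h2 := LinearMap.congr_fun (repOut_repIn_sub e u) (repOut e u x)
    have h3 := LinearMap.congr_fun (repOut_repIn_sub e (u + 1))
    have h4 := LinearMap.congr_fun (repOut_repIn_add e (u - 1))
    have hc := LinearMap.congr_fun (mulX_mulY_comm e).eq (repOut e u x)
    simp only [LinearMap.comp_apply, add_sub_cancel_right, sub_add_cancel] at h1 h2 h3 h4
    simp only [Module.End.mul_apply] at hc
    simp [repTheta, h1, h2, h3, h4, hc]

/-- The representation of `T_∞` on `RepSpace e`. -/
noncomputable def rep : TInfty →ₐ[Cv] Module.End Cv (RepSpace e) :=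
  RingQuot.liftAlgHom Cv ⟨FreeAlgebra.lift Cv (repTheta e), repTheta_rel e⟩

theorem rep_theta (w : Color) : rep e (theta w) = repIn e w ∘ₗ repOut e w := by
  rw [rep, theta, RingQuot.liftAlgHom_mkAlgHom_apply, FreeAlgebra.lift_ι_apply, repTheta]

theorem rep_hElt (u : Color) (k l : ℕ) : rep e (hElt u k l) =
    vNumber 2 ^ (k + l) • (repIn e (u + k - l) ∘ₗ (mulX e ^ k * mulY e ^ l) ∘ₗ repOut e u) := by
  induction l with
  | zero =>
    induction k with
    | zero => simp [hElt, rep_theta]; rfl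
    | succ k ih =>
      rw [hElt_succ_left, map_mul, rep_theta, ih]
      refine LinearMap.ext fun x => ?_
      have h := LinearMap.congr_fun (repOut_repIn_add e (u + k - (0 : ℕ)))
      simp only [LinearMap.comp_apply] at h
      simp only [Module.End.mul_apply, LinearMap.comp_apply, LinearMap.smul_apply, map_smul, h,
        pow_succ' (mulX e), pow_succ (vNumber 2), pow_zero, mul_one, smul_smul, add_zero]
      congr 3
      push_cast; ring
  | succ l ih =>
    rw [hElt_succ_right, map_mul, rep_theta, ih]
    refine LinearMap.ext fun x => ?_
    have h := LinearMap.congr_fun (repOut_repIn_sub e (u + k - l))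
    simp only [LinearMap.comp_apply] at h
    have hc : mulX e ^ k * mulY e ^ (l + 1) = mulY e * (mulX e ^ k * mulY e ^ l) := by
      rw [pow_succ', ← mul_assoc, ((mulX_mulY_comm e).pow_left k).eq, mul_assoc]
    rw [hc]
    simp only [Module.End.mul_apply, LinearMap.comp_apply, LinearMap.smul_apply, map_smul, h,
      smul_smul, ← add_assoc, pow_succ]
    congr 3
    · push_cast; ring

theorem rep_hMap (u : Color) {r : Color} {p : PairRing} (hp : p ∈ colorPart r) :
    rep e (hMap u p) = repIn e (u + r) ∘ₗ evalOp e p ∘ₗ repOut e u := by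
  induction hp using AddSubgroup.closure_induction with
  | zero => simp
  | add p p' _ _ h h' =>
    rw [map_add, map_add, map_add, h, h', LinearMap.add_comp, LinearMap.comp_add]
  | neg p _ h =>
    have h0 : rep e (hMap u (-p)) + rep e (hMap u p) = 0 := by
      rw [← map_add, ← map_add, neg_add_cancel, map_zero, map_zero]
    rw [eq_neg_of_add_eq_zero_left h0, h, map_neg, LinearMap.neg_comp, LinearMap.comp_neg]
  | mem x hx =>
    obtain ⟨k, l, a, h, rfl⟩ := hx
    rw [hMap_single, map_smul, rep_hElt, evalOp_single, ← h, add_sub, smul_smul]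
    have hc : vNumber 2 ^ (-(k : ℤ) - (l : ℤ)) * (a : Cv) * vNumber 2 ^ (k + l) = a := by
      rw [mul_right_comm, ← zpow_natCast, ← zpow_add₀ vNumber_two_ne_zero]
      push_cast
      rw [show -(k : ℤ) - l + (k + l) = 0 by ring, zpow_zero, one_mul]
    rw [hc]
    refine LinearMap.ext fun x => ?_
    simp [← Int.cast_smul_eq_zsmul Cv]

theorem rep_schurElt (u : Color) (a b : ℕ) : rep e (schurElt u a b) =
    repIn e (u + (a - b)) ∘ₗ evalOp e (schur pairX pairY a b) ∘ₗ repOut e u :=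
  rep_hMap e u (schur_mem_colorPart a b)

theorem rep_eq_zero_of_mem {x : TInfty} (hx : x ∈ (vanishingIdeal e).asIdeal) : rep e x = 0 := by
  rw [TwoSidedIdeal.mem_asIdeal] at hx
  have h : vanishingIdeal e ≤ TwoSidedIdeal.ker (rep e) := by
    rw [vanishingIdeal, TwoSidedIdeal.span_le]
    rintro _ ⟨u, m, n, hmn, rfl⟩
    rw [SetLike.mem_coe, TwoSidedIdeal.mem_ker, rightKL_eq_schurElt, rep_schurElt,
      evalOp_schur_eq_zero _ _ (by omega), LinearMap.zero_comp, LinearMap.comp_zero]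
  exact (TwoSidedIdeal.mem_ker _).1 (h hx)

/-- The representation of `T_e` on `RepSpace e`. -/
noncomputable def repLevel : TLevel e →ₐ[Cv] Module.End Cv (RepSpace e) :=
  Ideal.Quotient.liftₐ _ (rep e) fun _ => rep_eq_zero_of_mem e

theorem repLevel_proj (x : TInfty) : repLevel e (proj e x) = rep e x := rfl

/-- The vector on which `C^u_{m,n}` produces the basis vector at `(m, n)` in row `u + m - n`, and all
`C^v_{m,n}` with `v ≠ u` produce zero. -/
noncomputable def testVector (u : Color) : RepSpace e := (Pi.single u (delta e 1 1), 0)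

theorem repLevel_rightFamily_some (u v : Color) (mn : Alcove e) :
    repLevel e (rightFamily e (some (u, mn))) (testVector e v) =
      if u = v then repIn e (u + (mn.1.1 - mn.1.2)) (delta e (mn.1.1 + 1) (mn.1.2 + 1)) else 0 := by
  have hmn := mn.2
  rw [rightFamily, repLevel_proj, rightKL_eq_schurElt, rep_schurElt, LinearMap.comp_apply,
    LinearMap.comp_apply]
  have h : repOut e u (testVector e v) = if u = v then delta e 1 1 else 0 := by
    rw [repOut_apply, testVector]
    simp [Pi.single_apply]
  rw [h]
  split_ifs
  · rw [evalOp_schur_delta _ _ (by omega)]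
    push_cast
    rw [add_sub_add_right_eq_sub]
  · rw [map_zero, map_zero]

/-- Linear functionals on `T_e` dual to the right Kazhdan–Lusztig family: coordinates of the action on
the test vectors. -/
noncomputable def dualFamily : BasisIndex e → Module.Dual Cv (TLevel e)
  | none => LinearMap.proj ⟨(0, 0), Nat.zero_le e⟩ ∘ₗ LinearMap.proj 0 ∘ₗ LinearMap.fst Cv _ _ ∘ₗ
      LinearMap.applyₗ (testVector e 0) ∘ₗ (repLevel e).toLinearMap
  | some (u, mn) => LinearMap.proj mn ∘ₗ LinearMap.proj (u + (mn.1.1 - mn.1.2)) ∘ₗ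
      LinearMap.snd Cv _ _ ∘ₗ LinearMap.applyₗ (testVector e u) ∘ₗ (repLevel e).toLinearMap

theorem dualFamily_none (x : TLevel e) : dualFamily e none x =
    (repLevel e x (testVector e 0)).1 0 ⟨(0, 0), Nat.zero_le e⟩ := rfl

theorem dualFamily_some (u : Color) (mn : Alcove e) (x : TLevel e) : dualFamily e (some (u, mn)) x =
    (repLevel e x (testVector e u)).2 (u + (mn.1.1 - mn.1.2)) mn := rfl

theorem repLevel_rightFamily_none (v : Color) :
    repLevel e (rightFamily e none) (testVector e v) = testVector e v := by
  rw [rightFamily, map_one, Module.End.one_apply]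

theorem linearIndependent_rightFamily : LinearIndependent Cv (rightFamily e) := by
  refine LinearIndependent.of_pairwise_dual_eq_zero_one _ (dualFamily e) ?_ ?_
  · rintro (_ | ⟨u, mn⟩) (_ | ⟨v, kl⟩) hne
    · exact absurd rfl hne
    · rw [dualFamily_none, repLevel_rightFamily_some]
      split_ifs
      · rw [repIn_fst]; rfl
      · rfl
    · rw [dualFamily_some, repLevel_rightFamily_none]; rfl
    · rw [dualFamily_some, repLevel_rightFamily_some]
      split_ifs with h
      · subst h
        rw [repIn_snd, Pi.single_apply]
        split_ifs
        · refine if_neg fun h => hne ?_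
          rw [show mn = kl from Subtype.ext (Prod.ext (by omega) (by omega))]
        · rfl
      · rfl
  · rintro (_ | ⟨u, mn⟩)
    · rw [dualFamily_none, repLevel_rightFamily_none, testVector]
      simp only [Pi.single_eq_same]
      exact if_pos ⟨rfl, rfl⟩
    · rw [dualFamily_some, repLevel_rightFamily_some, if_pos rfl, repIn_snd, Pi.single_eq_same]
      exact if_pos ⟨rfl, rfl⟩

end Representation

/-! ### The two bases -/

section Bases

/-- The basis `1`, `C^u_{m,n}` of `T_e`. -/
noncomputable def rightBasis (e : ℕ) : Module.Basis (BasisIndex e) Cv (TLevel e) :=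
  Module.Basis.mk (linearIndependent_rightFamily e) (span_rightFamily e).ge

/-- The bijection from right to left starting colours, `u ↦ ρ^{m-n}(u)`. -/
def recolor (e : ℕ) : BasisIndex e ≃ BasisIndex e :=
  Equiv.optionCongr
    { toFun := fun x => (x.1 + (x.2.1.1 - x.2.1.2), x.2)
      invFun := fun x => (x.1 - (x.2.1.1 - x.2.1.2), x.2)
      left_inv := fun x => by simp
      right_inv := fun x => by simp }

theorem rightFamily_recolor_symm (e : ℕ) (i : BasisIndex e) :
    rightFamily e ((recolor e).symm i) = leftFamily e i := by
  rcases i with _ | ⟨u, mn⟩ <;> rfl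

theorem card_basisIndex (e : ℕ) :
    Nat.card (BasisIndex e) = 3 * ((e + 1) * (e + 2) / 2) + 1 := by
  rw [Nat.card_eq_fintype_card, Fintype.card_option, Fintype.card_prod, ZMod.card, card_alcove]

end Bases

end Trihedral

theorem proposition2p14 (e : ℕ) :
    (∃ b : Module.Basis (Trihedral.BasisIndex e) Trihedral.Cv (Trihedral.TLevel e),
      ∀ i, b i = Trihedral.rightFamily e i) ∧
    (∃ b : Module.Basis (Trihedral.BasisIndex e) Trihedral.Cv (Trihedral.TLevel e),
      ∀ i, b i = Trihedral.leftFamily e i) ∧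
    Module.finrank Trihedral.Cv (Trihedral.TLevel e) = 3 * ((e + 1) * (e + 2) / 2) + 1 := by
  refine ⟨⟨Trihedral.rightBasis e, fun i => ?_⟩,
    ⟨(Trihedral.rightBasis e).reindex (Trihedral.recolor e), fun i => ?_⟩, ?_⟩
  · rw [Trihedral.rightBasis, Module.Basis.mk_apply]
  · rw [Module.Basis.reindex_apply, Trihedral.rightBasis, Module.Basis.mk_apply,
      Trihedral.rightFamily_recolor_symm]
  · rw [Module.finrank_eq_nat_card_basis (Trihedral.rightBasis e), Trihedral.card_basisIndex]
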